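/- Let $N\ge 1$ be an integer, let $\hbar,g,\kappa>0$ and put $\rho=\kappa g^{2N}$. Let $\delta=(\delta_1,\dots,\delta_N)\in\mathbb C^N$ be a tuple that is invariant (with multiplicities) under complex conjugation and satisfies $|\operatorname{Im}\delta_k|<\hbar/2$ for all $k$, and put $\vartheta(\lambda)=\prod_{k=1}^N(\lambda-\delta_k)$. Let $Y_\delta:\mathbb R\to(0,\infty)$ be such that $\ln Y_\delta$ is continuous, nonnegative and bounded and solves the nonlinear integral equation $$\ln Y_\delta(\lambda)=\int_{\mathbb R}\frac{\hbar}{\pi\big((\lambda-\mu)^2+\hbar^2\big)}\,\ln\Big(1+\frac{\rho^\hbar\,Y_\delta(\mu)}{|\vartheta(\mu-i\hbar/2)|^2}\Big)\,d\mu\qquad(\lambda\in\mathbb R).$$ Then the integrals in $$\ln v_\uparrow(\lambda)=-\int_{\mathbb R}\frac{d\mu}{2i\pi}\,\frac{1}{\lambda-\mu+i\hbar/2}\,\ln\Big(1+\frac{\rho^\hbar Y_\delta(\mu)}{\vartheta(\mu-i\hbar/2)\vartheta(\mu+i\hbar/2)}\Big)\qquad(\operatorname{Im}\lambda>-\hbar/2),$$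 $$\ln v_\downarrow(\lambda-i\hbar)=\int_{\mathbb R}\frac{d\mu}{2i\pi}\,\frac{1}{\lambda-\mu-i\hbar/2}\,\ln\Big(1+\frac{\rho^\hbar Y_\delta(\mu)}{\vartheta(\mu-i\hbar/2)\vartheta(\mu+i\hbar/2)}\Big)\qquad(\operatorname{Im}\lambda<\hbar/2)$$ converge absolutely, and the functions $$Q_\delta^+(\lambda)=\frac{(\kappa g^N)^{-i\lambda}\,\hbar^{iN\lambda/\hbar}\,e^{-N\pi\lambda/\hbar}\,v_\uparrow(\lambda)}{\prod_{k=1}^N\Gamma\big(1-i(\lambda-\delta_k)/\hbar\big)}\quad(\operatorname{Im}\lambda>-\hbar/2),$$ $$Q_\delta^-(\lambda)=\frac{g^{iN\lambda}\,\hbar^{-iN\lambda/\hbar}\,e^{-N\pi\lambda/\hbar}\,v_\downarrow(\lambda-i\hbar)}{\prod_{k=1}^N\Gamma\big(1+i(\lambda-\delta_k)/\hbar\big)}\quad(\operatorname{Im}\lambda<\hbar/2)$$ extend to entire functions of $\lambda$, still denoted $Q_\delta^\pm$. Moreover, both as $\operatorname{Re}\lambda\to+\infty$ and as $\operatorname{Re}\lambda\to-\infty$,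 each of the two functions satisfies $$|Q_\delta^\pm(\lambda)|=\big|e^{-N\pi\lambda/\hbar}\big|\cdot O\Big(e^{\frac{N\pi}{2\hbar}|\operatorname{Re}\lambda|}\,|\lambda|^{\frac{N}{2\hbar}(\mp2\operatorname{Im}\lambda-\hbar)}\Big),$$ with the upper sign for $Q_\delta^+$ and the lower sign for $Q_\delta^-$, uniformly in the closed strip $|\operatorname{Im}\lambda|\le\hbar/2$. -/

import Mathlib

noncomputable section

namespace TodaTBA

/-- The monic polynomial `ϑ(z) = ∏ₖ (z - δₖ)` with prescribed roots. -/
def vartheta {N : ℕ} (δ : Fin N → ℂ) (z : ℂ) : ℂ := ∏ k, (z - δ k)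

/-- The tuple `δ` is invariant, with multiplicities, under complex conjugation. -/
def SelfConjugate {N : ℕ} (δ : Fin N → ℂ) : Prop :=
  ∃ σ : Equiv.Perm (Fin N), ∀ k, (starRingEnd ℂ) (δ k) = δ (σ k)

/-- The deformation parameter `ρ = κ g^(2N)`. -/
def rho (N : ℕ) (g κ : ℝ) : ℝ := κ * g ^ (2 * N)

/-- The kernel `K(x) = ħ / (π (x² + ħ²))`. -/
def kernelK (hbar x : ℝ) : ℝ := hbar / (Real.pi * (x ^ 2 + hbar ^ 2))

/-- `Y` is positive on the real line, `log Y` is continuous, nonnegative and bounded there, and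
`log Y(x) = ∫ K(x - μ) log (1 + ρ^ħ Y(μ) / |ϑ(μ - iħ/2)|²) dμ` for all real `x`. -/
structure IsNLIESolution {N : ℕ} (hbar g κ : ℝ) (δ : Fin N → ℂ) (Y : ℝ → ℝ) : Prop where
  pos : ∀ x, 0 < Y x
  continuous_log : Continuous fun x => Real.log (Y x)
  log_nonneg : ∀ x, 0 ≤ Real.log (Y x)
  log_bounded : ∃ C : ℝ, ∀ x, Real.log (Y x) ≤ C
  nlie : ∀ x, Real.log (Y x) = ∫ μ : ℝ, kernelK hbar (x - μ) *
    Real.log (1 + rho N g κ ^ hbar * Y μ /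
      ‖vartheta δ ((μ : ℂ) - Complex.I * hbar / 2)‖ ^ 2)

/-- `ln (1 + ρ^ħ Y(μ) / (ϑ(μ - iħ/2) ϑ(μ + iħ/2)))` for real `μ`. -/
def logV {N : ℕ} (hbar g κ : ℝ) (δ : Fin N → ℂ) (Y : ℝ → ℝ) (μ : ℝ) : ℂ :=
  Complex.log (1 + ((rho N g κ ^ hbar * Y μ : ℝ) : ℂ) /
    (vartheta δ ((μ : ℂ) - Complex.I * hbar / 2) * vartheta δ ((μ : ℂ) + Complex.I * hbar / 2)))

/-- The integrand of `ln v↑(z)`, without its sign. -/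
def upIntegrand {N : ℕ} (hbar g κ : ℝ) (δ : Fin N → ℂ) (Y : ℝ → ℝ) (z : ℂ) (μ : ℝ) : ℂ :=
  1 / (2 * Complex.I * Real.pi) * (1 / (z - μ + Complex.I * hbar / 2)) * logV hbar g κ δ Y μ

/-- The integrand of `ln v↓(z - iħ)`. -/
def downIntegrand {N : ℕ} (hbar g κ : ℝ) (δ : Fin N → ℂ) (Y : ℝ → ℝ) (z : ℂ) (μ : ℝ) : ℂ :=
  1 / (2 * Complex.I * Real.pi) * (1 / (z - μ - Complex.I * hbar / 2)) * logV hbar g κ δ Y μ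

/-- `v↑(z)`, given by its integral representation in the half-plane `Im z > -ħ/2`. -/
def vUp {N : ℕ} (hbar g κ : ℝ) (δ : Fin N → ℂ) (Y : ℝ → ℝ) (z : ℂ) : ℂ :=
  Complex.exp (-∫ μ : ℝ, upIntegrand hbar g κ δ Y z μ)

/-- `v↓(z - iħ)` as a function of `z`, given by its integral representation in the half-plane
`Im z < ħ/2`. -/
def vDownShift {N : ℕ} (hbar g κ : ℝ) (δ : Fin N → ℂ) (Y : ℝ → ℝ) (z : ℂ) : ℂ :=
  Complex.exp (∫ μ : ℝ, downIntegrand hbar g κ δ Y z μ)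

/-- The expression for `Q⁺(z)` in the half-plane `Im z > -ħ/2`. -/
def QplusExpr {N : ℕ} (hbar g κ : ℝ) (δ : Fin N → ℂ) (Y : ℝ → ℝ) (z : ℂ) : ℂ :=
  ((κ * g ^ N : ℝ) : ℂ) ^ (-Complex.I * z) * (hbar : ℂ) ^ (Complex.I * N * z / hbar) *
      Complex.exp (-(N * Real.pi / hbar) * z) * vUp hbar g κ δ Y z /
    ∏ k, Complex.Gamma (1 - Complex.I * (z - δ k) / hbar)

/-- The expression for `Q⁻(z)` in the half-plane `Im z < ħ/2`. -/
def QminusExpr {N : ℕ} (hbar g κ : ℝ) (δ : Fin N → ℂ) (Y : ℝ → ℝ) (z : ℂ) : ℂ :=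
  (g : ℂ) ^ (Complex.I * N * z) * (hbar : ℂ) ^ (-Complex.I * N * z / hbar) *
      Complex.exp (-(N * Real.pi / hbar) * z) * vDownShift hbar g κ δ Y z /
    ∏ k, Complex.Gamma (1 + Complex.I * (z - δ k) / hbar)

/-- The filter "`Re z → ±∞` inside the closed strip `|Im z| ≤ ħ/2`". A `=O` along it is
uniform in the strip, with respect to `Im z`, and covers both ends of the strip. -/
def stripEnds (hbar : ℝ) : Filter ℂ :=
  Filter.comap (fun z : ℂ => |z.re|) Filter.atTop ⊓ Filter.principal {z : ℂ | |z.im| ≤ hbar / 2}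

end TodaTBA

end

/-!
Put `L = ln (1 + ρ^ħ Y / |ϑ(· - iħ/2)|²)` and let `V = exp (-(1 / 2πi) ∫ L μ / (· - μ) dμ)`, so that
`v↑(z) = V(z + iħ/2)` and `v↓(z - iħ) = 1 / V(z - iħ/2)`. By Plemelj's formula the continuation of
`V` across the real line from above is `W V`, where `W` continues `exp L`. As the kernel of the
integral equation is a Poisson kernel, that equation reads `Y(x) = V(x + iħ) / V(x - iħ)` on the
real line, which expresses `W` through `V` and `ϑ`. The poles of `W` below the real line are zeros
of `ϑ(· + iħ/2)` and are cancelled by the factors `1 / Γ`: for the continuation `F` of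
`f(w) = V(w) ∏ₖ 1 / Γ(1 - i(w - iħ/2 - δₖ)/ħ)` from above, the relation becomes
`F(w) = f(w) + q(w) F(w + iħ)` with `f` and `q` holomorphic in the lower half-plane, and repeated
use of it shows that `F` is entire.

The Poisson formula for `ln |V|` bounds `V` in the upper half-plane by the supremum of `L`, so the
growth of `Q⁺` in the strip is that of the product of the `1 / Γ`. The upper bound for `Γ` in
vertical strips comes from the Phragmén–Lindelöf principle and the explicit value of `|Γ|` on
`Re s = 1/2`. The function `Q⁻` is obtained from `Q⁺` by complex conjugation.
-/

open MeasureTheory Filter Topology Set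

namespace TodaTBA

section HolomorphicIntegral

variable {α E : Type*} [MeasurableSpace α] {m : Measure α} [NormedAddCommGroup E]

theorem aestronglyMeasurable_deriv_of_ae_differentiableAt {𝕜 : Type*} [NontriviallyNormedField 𝕜]
    [NormedSpace 𝕜 E] {F : 𝕜 → α → E} {z₀ : 𝕜}
    (hmeas : ∀ᶠ z in 𝓝 z₀, AEStronglyMeasurable (F z) m)
    (hdiff : ∀ᵐ a ∂m, DifferentiableAt 𝕜 (F · a) z₀) :
    AEStronglyMeasurable (fun a => deriv (F · a) z₀) m := by
  obtain ⟨u, hu, hFu⟩ := exists_seq_forall_of_frequently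
    (hmeas.filter_mono (nhdsWithin_le_nhds (s := {z₀}ᶜ))).frequently
  refine aestronglyMeasurable_of_tendsto_ae atTop (f := fun n a => slope (F · a) z₀ (u n))
    (fun n => ((hFu n).sub hmeas.self_of_nhds).const_smul _) ?_
  filter_upwards [hdiff] with a ha using ha.hasDerivAt.tendsto_slope.comp hu

theorem differentiableOn_integral_of_dominated [NormedSpace ℂ E]
    {U : Set ℂ} (hU : IsOpen U) {F : ℂ → α → E} {b : α → ℝ} (hb : Integrable b m)
    (hmeas : ∀ z ∈ U, AEStronglyMeasurable (F z) m)
    (hdiff : ∀ᵐ a ∂m, DifferentiableOn ℂ (F · a) U)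
    (hbound : ∀ᵐ a ∂m, ∀ z ∈ U, ‖F z a‖ ≤ b a) :
    DifferentiableOn ℂ (fun z => ∫ a, F z a ∂m) U := by
  intro z₀ hz₀
  obtain ⟨ε, hε, hball⟩ := Metric.isOpen_iff.1 hU z₀ hz₀
  have hclosedBall : ∀ x ∈ Metric.ball z₀ (ε / 2), Metric.closedBall x (ε / 2) ⊆ U := fun x hx =>
    (Metric.closedBall_subset_ball' (by linarith [Metric.mem_ball.1 hx])).trans hball
  have hmem : ∀ x ∈ Metric.ball z₀ (ε / 2), U ∈ 𝓝 x := fun x hx =>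
    mem_of_superset (Metric.closedBall_mem_nhds x (half_pos hε)) (hclosedBall x hx)
  refine (hasDerivAt_integral_of_dominated_loc_of_deriv_le
    (F' := fun z a => deriv (F · a) z) (bound := fun a => b a / (ε / 2))
    (Metric.ball_mem_nhds z₀ (half_pos hε)) ((hU.eventually_mem hz₀).mono hmeas)
    (hb.mono' (hmeas _ hz₀) (hbound.mono fun a ha => ha z₀ hz₀)) ?_ ?_ (hb.div_const _)
    ?_).2.differentiableAt.differentiableWithinAt
  · exact aestronglyMeasurable_deriv_of_ae_differentiableAt ((hU.eventually_mem hz₀).mono hmeas)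
      (hdiff.mono fun a ha => ha.differentiableAt (hU.mem_nhds hz₀))
  · filter_upwards [hdiff, hbound] with a hda hba x hx
    refine Complex.norm_deriv_le_of_forall_mem_sphere_norm_le (half_pos hε)
      (DifferentiableOn.diffContOnCl ?_)
      fun z hz => hba z (hclosedBall x hx (Metric.sphere_subset_closedBall hz))
    exact hda.mono (Metric.closure_ball_subset_closedBall.trans (hclosedBall x hx))
  · filter_upwards [hdiff] with a ha x hx using (ha.differentiableAt (hmem x hx)).hasDerivAt

end HolomorphicIntegral

section CauchyTransform

/-- The Cauchy transform of a function on the real line; no factor `1 / (2πi)` is included. -/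
noncomputable def cauchyTransform (L : ℝ → ℂ) (z : ℂ) : ℂ := ∫ μ : ℝ, L μ / (z - μ)

variable {L : ℝ → ℂ} {l : ℂ → ℂ} {z : ℂ}

theorem abs_im_le_norm_sub_ofReal (z : ℂ) (μ : ℝ) : |z.im| ≤ ‖z - μ‖ := by
  simpa using Complex.abs_im_le_norm (z - μ)

theorem sub_ofReal_ne_zero (hz : z.im ≠ 0) (μ : ℝ) : z - μ ≠ 0 :=
  norm_pos_iff.1 ((abs_pos.2 hz).trans_le (abs_im_le_norm_sub_ofReal z μ))

theorem aestronglyMeasurable_div_sub {m : Measure ℝ} (hL : AEStronglyMeasurable L m)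
    (z : ℂ) : AEStronglyMeasurable (fun μ : ℝ => L μ / (z - μ)) m :=
  hL.div₀ (by fun_prop : Measurable fun μ : ℝ => z - (μ : ℂ)).aestronglyMeasurable

theorem norm_div_le_norm_mul_inv {c w : ℂ} {d : ℝ} (hd : 0 < d) (hw : d ≤ ‖w‖) :
    ‖c / w‖ ≤ ‖c‖ * d⁻¹ := by
  rw [norm_div, div_eq_mul_inv]
  gcongr

theorem integrable_div_sub (hL : Integrable L) (hz : z.im ≠ 0) :
    Integrable fun μ : ℝ => L μ / (z - μ) :=
  (hL.norm.mul_const _).mono' (aestronglyMeasurable_div_sub hL.1 z)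
    (Eventually.of_forall fun μ =>
      norm_div_le_norm_mul_inv (abs_pos.2 hz) (abs_im_le_norm_sub_ofReal z μ))

theorem differentiableAt_setIntegral_div_sub (hL : Integrable L) {S : Set ℝ}
    (hS : MeasurableSet S) {d : ℝ} (hd : 0 < d) (hdist : ∀ μ ∈ S, d ≤ ‖z - μ‖) :
    DifferentiableAt ℂ (fun w => ∫ μ in S, L μ / (w - μ)) z := by
  have hball : ∀ μ ∈ S, ∀ w ∈ Metric.ball z (d / 2), d / 2 ≤ ‖w - μ‖ := by
    intro μ hμ w hw
    rw [mem_ball_iff_norm'] at hw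
    linarith [hdist μ hμ, norm_sub_le_norm_sub_add_norm_sub z w (μ : ℂ)]
  refine (differentiableOn_integral_of_dominated Metric.isOpen_ball
    (b := fun μ => ‖L μ‖ * (d / 2)⁻¹) (hL.norm.mul_const _).integrableOn
    (fun w _ => aestronglyMeasurable_div_sub hL.1.restrict w) ?_ ?_).differentiableAt
    (Metric.ball_mem_nhds z (half_pos hd))
  · filter_upwards [ae_restrict_mem hS] with μ hμ w hw
    have hne : w - μ ≠ 0 := norm_pos_iff.1 ((half_pos hd).trans_le (hball μ hμ w hw))
    exact ((differentiableAt_const (L μ)).fun_div (differentiableAt_id.sub_const (μ : ℂ))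
      hne).differentiableWithinAt
  · filter_upwards [ae_restrict_mem hS] with μ hμ w hw
    exact norm_div_le_norm_mul_inv (half_pos hd) (hball μ hμ w hw)

theorem differentiableAt_cauchyTransform (hL : Integrable L) (hz : z.im ≠ 0) :
    DifferentiableAt ℂ (cauchyTransform L) z := by
  have h := differentiableAt_setIntegral_div_sub hL MeasurableSet.univ (abs_pos.2 hz)
    fun μ _ => abs_im_le_norm_sub_ofReal z μ
  rwa [Measure.restrict_univ] at h

theorem conj_cauchyTransform (L : ℝ → ℂ) (z : ℂ) :
    starRingEnd ℂ (cauchyTransform L z) =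
      cauchyTransform (fun μ => starRingEnd ℂ (L μ)) (starRingEnd ℂ z) := by
  simp only [cauchyTransform, ← integral_conj, map_div₀, map_sub, Complex.conj_ofReal]

theorem dslope_comm (l : ℂ → ℂ) (a b : ℂ) : dslope l a b = dslope l b a := by
  rcases eq_or_ne a b with rfl | h
  · rfl
  · rw [dslope_of_ne _ h.symm, dslope_of_ne _ h, slope_comm]

theorem norm_dslope_le_of_norm_deriv_le {U : Set ℂ} (hU : IsOpen U) (hconv : Convex ℝ U)
    (hl : DifferentiableOn ℂ l U) {K : ℝ} (hK : ∀ w ∈ U, ‖deriv l w‖ ≤ K) {w z : ℂ}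
    (hw : w ∈ U) (hz : z ∈ U) : ‖dslope l w z‖ ≤ K := by
  rcases eq_or_ne z w with rfl | h
  · rw [dslope_same]; exact hK _ hz
  · rw [dslope_of_ne _ h, slope_def_field, norm_div,
      div_le_iff₀ (norm_pos_iff.2 (sub_ne_zero.2 h))]
    exact hconv.norm_image_sub_le_of_norm_deriv_le
      (fun x hx => hl.differentiableAt (hU.mem_nhds hx)) hK hw hz

theorem differentiableOn_setIntegral_dslope {U : Set ℂ} (hU : IsOpen U) (hconv : Convex ℝ U)
    (hl : DifferentiableOn ℂ l U) {K : ℝ} (hK : ∀ w ∈ U, ‖deriv l w‖ ≤ K) {S : Set ℝ}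
    (hS : MeasurableSet S) (hS_fin : volume S ≠ ⊤) (hSU : ∀ μ ∈ S, (μ : ℂ) ∈ U) :
    DifferentiableOn ℂ (fun z => ∫ μ in S, dslope l (μ : ℂ) z) U := by
  have hd : ∀ w ∈ U, DifferentiableOn ℂ (dslope l w) U := fun w hw =>
    (Complex.differentiableOn_dslope (hU.mem_nhds hw)).2 hl
  refine differentiableOn_integral_of_dominated (b := fun _ => K) hU
    (integrableOn_const hS_fin) (fun z hz => ?_) ?_ ?_
  · simp only [dslope_comm l _ z]
    exact ((hd z hz).continuousOn.comp Complex.continuous_ofReal.continuousOn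
      hSU).aestronglyMeasurable hS
  · filter_upwards [ae_restrict_mem hS] with μ hμ using hd μ (hSU μ hμ)
  · filter_upwards [ae_restrict_mem hS] with μ hμ z hz
    exact norm_dslope_le_of_norm_deriv_le hU hconv hl hK (hSU μ hμ) hz

theorem log_neg_of_im_neg (hz : z.im < 0) :
    Complex.log (-z) = Complex.log z + Real.pi * Complex.I := by
  rw [Complex.log, Complex.log, norm_neg, Complex.arg_neg_eq_arg_add_pi_of_im_neg hz]
  push_cast; ring

theorem log_neg_of_im_pos (hz : 0 < z.im) :
    Complex.log (-z) = Complex.log z - Real.pi * Complex.I := by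
  rw [Complex.log, Complex.log, norm_neg, Complex.arg_neg_eq_arg_sub_pi_of_im_pos hz]
  push_cast; ring

theorem continuous_inv_sub_ofReal (hz : z.im ≠ 0) : Continuous fun μ : ℝ => (z - μ)⁻¹ :=
  Continuous.inv₀ (by fun_prop) (sub_ofReal_ne_zero hz)

theorem intervalIntegral_inv_sub_ofReal (a b : ℝ) (hz : z.im ≠ 0) :
    ∫ μ in a..b, (z - μ)⁻¹ = Complex.log (z - a) - Complex.log (z - b) := by
  have hderiv : ∀ x ∈ uIcc a b,
      HasDerivAt (fun x : ℝ => -Complex.log (z - x)) ((z - x)⁻¹) x := by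
    intro x _
    have hsub : HasDerivAt (fun x : ℝ => z - (x : ℂ)) (-1) x := by
      simpa using (Complex.ofRealCLM.hasDerivAt (x := x)).const_sub z
    simpa only [neg_div, neg_neg, one_div] using
      (hsub.clog_real (Or.inr (by simpa using hz))).fun_neg
  rw [intervalIntegral.integral_eq_sub_of_hasDerivAt hderiv
    ((continuous_inv_sub_ofReal hz).intervalIntegrable a b)]
  ring

/-- The continuation of `cauchyTransform L` from the upper half-plane across the interval `(a, b)`,
on which `L` is the restriction of the holomorphic function `l`: the singularity on the interval is
removed by subtracting `l z / (z - μ)`, whose integral is a difference of logarithms. -/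
noncomputable def plemeljContinuation (L : ℝ → ℂ) (l : ℂ → ℂ) (a b : ℝ) (z : ℂ) : ℂ :=
  (∫ μ in (Ioc a b)ᶜ, L μ / (z - μ)) - (∫ μ in Ioc a b, dslope l (μ : ℂ) z) +
    l z * (Complex.log (z - a) - Complex.log (b - z) - Real.pi * Complex.I)

theorem cauchyTransform_eq_of_eqOn_Ioc (hL : Integrable L) {a b : ℝ} (hab : a ≤ b)
    (hl : ∀ μ ∈ Ioc a b, l μ = L μ) (hz : z.im ≠ 0) :
    cauchyTransform L z =
      (∫ μ in (Ioc a b)ᶜ, L μ / (z - μ)) - (∫ μ in Ioc a b, dslope l (μ : ℂ) z) +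
        l z * (Complex.log (z - a) - Complex.log (z - b)) := by
  have hdslope : ∀ μ ∈ Ioc a b, dslope l (μ : ℂ) z = l z * (z - μ)⁻¹ - L μ / (z - μ) := by
    intro μ hμ
    have hne := sub_ofReal_ne_zero hz μ
    rw [dslope_of_ne _ (sub_ne_zero.1 hne), slope_def_field, hl μ hμ]
    field_simp
  have hint := integrable_div_sub hL hz
  rw [cauchyTransform, ← integral_add_compl measurableSet_Ioc hint,
    ← intervalIntegral_inv_sub_ofReal a b hz, intervalIntegral.integral_of_le hab,
    ← integral_const_mul, setIntegral_congr_fun measurableSet_Ioc hdslope,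
    integral_sub ((continuous_inv_sub_ofReal hz).const_mul _).integrableOn_Ioc hint.integrableOn]
  ring

theorem plemeljContinuation_of_im_pos (hL : Integrable L) {a b : ℝ} (hab : a ≤ b)
    (hl : ∀ μ ∈ Ioc a b, l μ = L μ) (hz : 0 < z.im) :
    plemeljContinuation L l a b z = cauchyTransform L z := by
  rw [plemeljContinuation, cauchyTransform_eq_of_eqOn_Ioc hL hab hl hz.ne', ← neg_sub (b : ℂ) z,
    log_neg_of_im_neg (by simpa using hz)]
  ring

theorem plemeljContinuation_of_im_neg (hL : Integrable L) {a b : ℝ} (hab : a ≤ b)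
    (hl : ∀ μ ∈ Ioc a b, l μ = L μ) (hz : z.im < 0) :
    plemeljContinuation L l a b z = cauchyTransform L z - 2 * Real.pi * Complex.I * l z := by
  rw [plemeljContinuation, cauchyTransform_eq_of_eqOn_Ioc hL hab hl hz.ne, ← neg_sub (b : ℂ) z,
    log_neg_of_im_pos (by simpa using hz)]
  ring

theorem differentiableOn_plemeljContinuation (hL : Integrable L) {x R K : ℝ}
    (hl : DifferentiableOn ℂ l (Metric.ball (x : ℂ) R))
    (hK : ∀ w ∈ Metric.ball (x : ℂ) R, ‖deriv l w‖ ≤ K) {r : ℝ} (hrR : r < R) :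
    DifferentiableOn ℂ (plemeljContinuation L l (x - r) (x + r)) (Metric.ball (x : ℂ) r) := by
  have hball := Metric.ball_subset_ball (x := (x : ℂ)) hrR.le
  have hIoc : ∀ μ ∈ Ioc (x - r) (x + r), (μ : ℂ) ∈ Metric.ball (x : ℂ) R := by
    intro μ hμ
    rw [mem_ball_iff_norm, ← Complex.ofReal_sub, Complex.norm_real, Real.norm_eq_abs, abs_lt]
    constructor <;> linarith [hμ.1, hμ.2]
  have hfar : DifferentiableOn ℂ (fun z => ∫ μ in (Ioc (x - r) (x + r))ᶜ, L μ / (z - μ))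
      (Metric.ball (x : ℂ) r) := by
    intro z hz
    refine (differentiableAt_setIntegral_div_sub hL measurableSet_Ioc.compl
      (d := r - ‖z - x‖) (sub_pos.2 (mem_ball_iff_norm.1 hz)) ?_).differentiableWithinAt
    intro μ hμ
    have hμr : r ≤ ‖(μ : ℂ) - x‖ := by
      rw [← Complex.ofReal_sub, Complex.norm_real, Real.norm_eq_abs]
      by_contra! h
      exact hμ ⟨by linarith [(abs_lt.1 h).1], by linarith [(abs_lt.1 h).2]⟩
    rw [norm_sub_rev z (μ : ℂ)]
    linarith [norm_sub_le_norm_sub_add_norm_sub (μ : ℂ) z x]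
  have hnear := (differentiableOn_setIntegral_dslope Metric.isOpen_ball (convex_ball _ _) hl hK
    measurableSet_Ioc (by simp) hIoc).mono hball
  refine (hfar.sub hnear).add ((hl.mono hball).mul fun z hz => ?_)
  have hre := abs_lt.1 ((Complex.abs_re_le_norm (z - x)).trans_lt (mem_ball_iff_norm.1 hz))
  rw [Complex.sub_re, Complex.ofReal_re] at hre
  have hza : z - (x - r : ℝ) ∈ Complex.slitPlane := Or.inl <| by
    rw [Complex.sub_re, Complex.ofReal_re]
    linarith [hre.1]
  have hzb : (x + r : ℝ) - z ∈ Complex.slitPlane := Or.inl <| by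
    rw [Complex.sub_re, Complex.ofReal_re]
    linarith [hre.2]
  exact (((differentiableAt_id.sub_const _).clog hza).sub
    ((differentiableAt_id.const_sub _).clog hzb)).sub_const _ |>.differentiableWithinAt

theorem exists_continuation_cauchyTransform (hL : Integrable L) {x : ℝ}
    (hl : ∀ᶠ z in 𝓝 (x : ℂ), DifferentiableAt ℂ l z) (hlL : ∀ᶠ μ : ℝ in 𝓝 x, l μ = L μ) :
    ∃ g : ℂ → ℂ, ∀ᶠ z in 𝓝 (x : ℂ), DifferentiableAt ℂ g z ∧
      (0 < z.im → g z = cauchyTransform L z) ∧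
      (z.im < 0 → g z = cauchyTransform L z - 2 * Real.pi * Complex.I * l z) := by
  have hderiv : ∀ᶠ z in 𝓝 (x : ℂ), ‖deriv l z‖ < ‖deriv l x‖ + 1 :=
    (Complex.analyticAt_iff_eventually_differentiableAt.2 hl).deriv.continuousAt.norm.eventually_lt
      continuousAt_const (lt_add_one _)
  obtain ⟨R, hR, hlR⟩ := Metric.eventually_nhds_iff_ball.1 (hl.and hderiv)
  obtain ⟨R', hR', hlLR⟩ := Metric.eventually_nhds_iff_ball.1 hlL
  obtain ⟨r, hr, hrR⟩ := exists_between (lt_min hR hR')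
  have hIoc : ∀ μ ∈ Ioc (x - r) (x + r), l μ = L μ := by
    refine fun μ hμ => hlLR μ ?_
    rw [Real.ball_eq_Ioo]
    constructor <;> linarith [hμ.1, hμ.2, hrR.trans_le (min_le_right R R')]
  have hab : x - r ≤ x + r := by linarith
  have hd := differentiableOn_plemeljContinuation hL
    (fun z hz => (hlR z hz).1.differentiableWithinAt) (fun z hz => (hlR z hz).2.le)
    (hrR.trans_le (min_le_left _ _))
  refine ⟨plemeljContinuation L l (x - r) (x + r), ?_⟩
  filter_upwards [Metric.isOpen_ball.mem_nhds (Metric.mem_ball_self (x := (x : ℂ)) hr)] with z hz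
  exact ⟨hd.differentiableAt (Metric.isOpen_ball.mem_nhds hz),
    plemeljContinuation_of_im_pos hL hab hIoc, plemeljContinuation_of_im_neg hL hab hIoc⟩

end CauchyTransform

section CauchyExp

/-- The exponential of `-1 / (2πi)` times the Cauchy transform of a real function `L`: a nowhere
vanishing holomorphic function off the real line, whose boundary values from above and below have
the quotient `exp L`. -/
noncomputable def cauchyExp (L : ℝ → ℝ) (z : ℂ) : ℂ :=
  Complex.exp (-(1 / (2 * Complex.I * Real.pi) * cauchyTransform (fun μ => (L μ : ℂ)) z))

variable {L : ℝ → ℝ} {z : ℂ}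

theorem cauchyExp_ne_zero (L : ℝ → ℝ) (z : ℂ) : cauchyExp L z ≠ 0 := Complex.exp_ne_zero _

theorem differentiableAt_cauchyExp (hL : Integrable L) (hz : z.im ≠ 0) :
    DifferentiableAt ℂ (cauchyExp L) z :=
  ((differentiableAt_cauchyTransform hL.ofReal hz).const_mul _).neg.cexp

theorem exists_continuation_cauchyExp (hL : Integrable L) {W : ℂ → ℂ} {x : ℝ}
    (hW : ∀ᶠ z in 𝓝 (x : ℂ), DifferentiableAt ℂ W z)
    (hWL : ∀ᶠ μ : ℝ in 𝓝 x, W μ = Real.exp (L μ)) :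
    ∃ g : ℂ → ℂ, ∀ᶠ z in 𝓝 (x : ℂ), DifferentiableAt ℂ g z ∧
      (0 < z.im → g z = cauchyExp L z) ∧ (z.im < 0 → g z = W z * cauchyExp L z) := by
  have hslit : ∀ᶠ z in 𝓝 (x : ℂ), W z ∈ Complex.slitPlane := by
    refine hW.self_of_nhds.continuousAt.eventually_mem (Complex.isOpen_slitPlane.mem_nhds ?_)
    rw [hWL.self_of_nhds]
    exact Complex.ofReal_mem_slitPlane.2 (Real.exp_pos _)
  obtain ⟨g, hg⟩ := exists_continuation_cauchyTransform (L := fun μ => (L μ : ℂ))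
    (l := fun z => Complex.log (W z)) hL.ofReal (hW.and hslit |>.mono fun z hz => hz.1.clog hz.2)
    (hWL.mono fun μ hμ => by rw [hμ, ← Complex.ofReal_log (Real.exp_pos _).le, Real.log_exp])
  refine ⟨fun z => Complex.exp (-(1 / (2 * Complex.I * Real.pi) * g z)), ?_⟩
  filter_upwards [hg, hslit] with z hgz hWz
  refine ⟨(hgz.1.const_mul _).neg.cexp, fun hz => by rw [hgz.2.1 hz]; rfl, fun hz => ?_⟩
  rw [hgz.2.2 hz, cauchyExp]
  nth_rw 2 [← Complex.exp_log (Complex.slitPlane_ne_zero hWz)]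
  rw [← Complex.exp_add]
  congr 1
  have := Complex.ofReal_ne_zero.2 Real.pi_ne_zero
  have := Complex.I_ne_zero
  field_simp
  ring

theorem conj_cauchyExp (L : ℝ → ℝ) (z : ℂ) :
    starRingEnd ℂ (cauchyExp L z) = (cauchyExp L (starRingEnd ℂ z))⁻¹ := by
  simp only [cauchyExp, ← Complex.exp_neg, ← Complex.exp_conj, map_neg, map_mul, map_div₀, map_one,
    map_ofNat, Complex.conj_I, Complex.conj_ofReal, conj_cauchyTransform]
  congr 1
  ring

theorem kernelK_mul_eq_neg_im_div (c : ℝ) (z : ℂ) (μ : ℝ) :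
    kernelK z.im (z.re - μ) * c = -((c : ℂ) / (z - μ)).im / Real.pi := by
  have hnormSq : Complex.normSq (z - μ) = (z.re - μ) ^ 2 + z.im ^ 2 := by
    simp only [Complex.normSq_apply, Complex.sub_re, Complex.sub_im, Complex.ofReal_re,
      Complex.ofReal_im]
    ring
  rw [kernelK, Complex.div_im, hnormSq]
  simp only [Complex.sub_re, Complex.sub_im, Complex.ofReal_re, Complex.ofReal_im, div_eq_mul_inv,
    mul_inv_rev]
  ring

theorem integrable_kernelK_mul (hL : Integrable L) (hz : z.im ≠ 0) :
    Integrable fun μ => kernelK z.im (z.re - μ) * L μ := by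
  simp only [kernelK_mul_eq_neg_im_div]
  exact (integrable_div_sub hL.ofReal hz).im.neg.div_const _

theorem norm_cauchyExp (hL : Integrable L) (hz : z.im ≠ 0) :
    ‖cauchyExp L z‖ = Real.exp ((∫ μ, kernelK z.im (z.re - μ) * L μ) / 2) := by
  have him : (cauchyTransform (fun μ => (L μ : ℂ)) z).im = ∫ μ, ((L μ : ℂ) / (z - μ)).im :=
    (integral_im (integrable_div_sub hL.ofReal hz)).symm
  have hre : ∀ w : ℂ, (-(1 / (2 * Complex.I * Real.pi) * w)).re = -w.im / Real.pi / 2 := by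
    intro w
    have hcoef : 1 / (2 * Complex.I * Real.pi) = (-(1 / (2 * Real.pi)) : ℝ) * Complex.I := by
      push_cast
      field_simp
      simp
    rw [hcoef, mul_assoc, Complex.neg_re, Complex.re_ofReal_mul, Complex.I_mul_re]
    ring
  simp only [kernelK_mul_eq_neg_im_div, integral_div, integral_neg]
  rw [cauchyExp, Complex.norm_exp, hre, him]

theorem kernelK_sub_eq_cauchyPDFReal (γ : NNReal) (x μ : ℝ) :
    kernelK γ (x - μ) = ProbabilityTheory.cauchyPDFReal x γ μ := by
  rw [kernelK, ProbabilityTheory.cauchyPDFReal_def, div_eq_mul_inv, mul_inv, ← neg_sub μ x, neg_sq]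
  ring

theorem norm_cauchyExp_le (hL : Integrable L) {M : ℝ} (hM : ∀ μ, L μ ≤ M) (hz : 0 < z.im) :
    ‖cauchyExp L z‖ ≤ Real.exp (M / 2) := by
  have hkernel : ∀ μ, kernelK z.im (z.re - μ) =
      ProbabilityTheory.cauchyPDFReal z.re z.im.toNNReal μ := fun μ => by
    rw [← kernelK_sub_eq_cauchyPDFReal, Real.coe_toNNReal _ hz.le]
  have hint := integrable_kernelK_mul hL hz.ne'
  simp only [norm_cauchyExp hL hz.ne', hkernel] at hint ⊢
  rw [Real.exp_le_exp]
  refine div_le_div_of_nonneg_right ?_ zero_le_two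
  have hγ : z.im.toNNReal ≠ 0 := (Real.toNNReal_pos.2 hz).ne'
  calc ∫ μ, ProbabilityTheory.cauchyPDFReal z.re z.im.toNNReal μ * L μ
      ≤ ∫ μ, ProbabilityTheory.cauchyPDFReal z.re z.im.toNNReal μ * M :=
        integral_mono hint ((ProbabilityTheory.integrable_cauchyPDFReal _).mul_const _) fun μ =>
          mul_le_mul_of_nonneg_left (hM μ) (ProbabilityTheory.cauchyPDF_pos _ hγ _).le
    _ = M := by
        rw [integral_mul_const, ProbabilityTheory.integral_cauchyPDFReal_eq_one _ hγ, one_mul]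

theorem cauchyExp_add_div_cauchyExp_sub (hL : Integrable L) {h : ℝ} (hh : h ≠ 0) (x : ℝ) :
    cauchyExp L (x + h * Complex.I) / cauchyExp L (x - h * Complex.I) =
      Real.exp (∫ μ, kernelK h (x - μ) * L μ) := by
  have hre : (x + h * Complex.I : ℂ).re = x := by simp
  have him : (x + h * Complex.I : ℂ).im = h := by simp
  have hconj : (cauchyExp L (x - h * Complex.I))⁻¹ =
      starRingEnd ℂ (cauchyExp L (x + h * Complex.I)) := by
    simp [conj_cauchyExp, sub_eq_add_neg]
  rw [div_eq_mul_inv, hconj, Complex.mul_conj, Complex.normSq_eq_norm_sq,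
    norm_cauchyExp hL (him.trans_ne hh), ← Real.exp_nat_mul, hre, him, Nat.cast_ofNat,
    mul_div_cancel₀ _ two_ne_zero]

end CauchyExp

section DownwardContinuation

theorem extendFrom_eventuallyEq {X Y : Type*} [TopologicalSpace X] [TopologicalSpace Y] [T2Space Y]
    {A : Set X} (hA : Dense A) {f g : X → Y} {x : X}
    (hg : ∀ᶠ w in 𝓝 x, ContinuousAt g w ∧ (w ∈ A → g w = f w)) :
    extendFrom A f =ᶠ[𝓝 x] g := by
  filter_upwards [eventually_eventually_nhds.2 hg] with w hw
  refine extendFrom_eq (hA w) ((hw.self_of_nhds.1.mono_left nhdsWithin_le_nhds).congr' ?_)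
  filter_upwards [nhdsWithin_le_nhds hw, self_mem_nhdsWithin] with v hv hvA using hv.2 hvA

theorem differentiableAt_extendFrom {𝕜 E F : Type*} [NontriviallyNormedField 𝕜]
    [NormedAddCommGroup E] [NormedSpace 𝕜 E] [NormedAddCommGroup F] [NormedSpace 𝕜 F] {A : Set E}
    (hA : Dense A) {f : E → F} {x : E}
    (h : ∃ g : E → F, ∀ᶠ w in 𝓝 x, DifferentiableAt 𝕜 g w ∧ (w ∈ A → g w = f w)) :
    DifferentiableAt 𝕜 (extendFrom A f) x ∧ (x ∈ A → extendFrom A f x = f x) := by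
  obtain ⟨g, hg⟩ := h
  have heq := extendFrom_eventuallyEq hA (hg.mono fun w hw => ⟨hw.1.continuousAt, hw.2⟩)
  exact ⟨hg.self_of_nhds.1.congr_of_eventuallyEq heq, fun hx =>
    heq.self_of_nhds.trans (hg.self_of_nhds.2 hx)⟩

theorem dense_im_ne_zero : Dense {z : ℂ | z.im ≠ 0} :=
  (dense_compl_singleton (0 : ℝ)).preimage Complex.isOpenMap_im

/-- The `n`-fold substitution of `F w = p w + q w * F (w + ih)` into itself, starting from `H`. -/
def iterateFunctionalEquation (h : ℝ) (p q H : ℂ → ℂ) : ℕ → ℂ → ℂ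
  | 0 => H
  | n + 1 => fun w => p w + q w * iterateFunctionalEquation h p q H n (w + h * Complex.I)

/-- The continuation of `H` from the half-plane `Im w > -h` to the whole plane by means of
`F w = p w + q w * F (w + ih)`: the argument is shifted upwards until it is in the half-plane. -/
noncomputable def downwardContinuation (h : ℝ) (p q H : ℂ → ℂ) (w : ℂ) : ℂ :=
  iterateFunctionalEquation h p q H ⌊-w.im / h⌋₊ w

variable {h : ℝ} {p q H : ℂ → ℂ}

theorem downwardContinuation_of_neg_lt_im (hh : 0 < h) {w : ℂ} (hw : -h < w.im) :
    downwardContinuation h p q H w = H w := by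
  have hfloor : ⌊-w.im / h⌋₊ = 0 := Nat.floor_eq_zero.2 ((div_lt_one hh).2 (by linarith))
  rw [downwardContinuation, hfloor, iterateFunctionalEquation]

theorem downwardContinuation_of_im_neg (hh : 0 < h)
    (hrec : ∀ w : ℂ, -h < w.im → w.im < 0 → H w = p w + q w * H (w + h * Complex.I))
    {w : ℂ} (hw : w.im < 0) :
    downwardContinuation h p q H w =
      p w + q w * downwardContinuation h p q H (w + h * Complex.I) := by
  rcases lt_or_ge (-h) w.im with hwh | hwh
  · have him : -h < (w + h * Complex.I).im := by simpa using by linarith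
    rw [downwardContinuation_of_neg_lt_im hh hwh, downwardContinuation_of_neg_lt_im hh him,
      hrec w hwh hw]
  · have hone : 1 ≤ ⌊-w.im / h⌋₊ := Nat.one_le_floor_iff _ |>.2 ((one_le_div hh).2 (by linarith))
    have him : -(w + h * Complex.I).im / h = -w.im / h - 1 := by
      rw [Complex.add_im, Complex.im_ofReal_mul, Complex.I_im, mul_one]
      field_simp
      ring
    rw [downwardContinuation, downwardContinuation, him, Nat.floor_sub_one,
      ← Nat.sub_add_cancel hone, iterateFunctionalEquation, Nat.add_sub_cancel]

theorem differentiable_downwardContinuation (hh : 0 < h)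
    (hp : ∀ w : ℂ, w.im < 0 → DifferentiableAt ℂ p w)
    (hq : ∀ w : ℂ, w.im < 0 → DifferentiableAt ℂ q w)
    (hH : ∀ w : ℂ, -h < w.im → DifferentiableAt ℂ H w)
    (hrec : ∀ w : ℂ, -h < w.im → w.im < 0 → H w = p w + q w * H (w + h * Complex.I)) :
    Differentiable ℂ (downwardContinuation h p q H) := by
  have htop : ∀ w : ℂ, -h < w.im → DifferentiableAt ℂ (downwardContinuation h p q H) w :=
    fun w hw => (hH w hw).congr_of_eventuallyEq <| by
      filter_upwards [Complex.continuous_im.continuousAt.eventually_const_lt hw] with v hv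
        using downwardContinuation_of_neg_lt_im hh hv
  have hlevel : ∀ n : ℕ, ∀ w : ℂ, -((n + 1) * h) < w.im →
      DifferentiableAt ℂ (downwardContinuation h p q H) w := by
    intro n
    induction n with
    | zero => simpa using htop
    | succ n ih =>
      intro w hw
      rcases lt_or_ge (-h) w.im with hwh | hwh
      · exact htop w hwh
      have hneg : w.im < 0 := by linarith
      have hshift : DifferentiableAt ℂ
          (fun v => downwardContinuation h p q H (v + h * Complex.I)) w := by
        refine differentiableAt_comp_add_const.2 (ih _ ?_)
        push_cast at hw
        simpa using by linarith
      refine ((hp w hneg).add ((hq w hneg).mul hshift)).congr_of_eventuallyEq ?_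
      filter_upwards [Complex.continuous_im.continuousAt.eventually_lt_const hneg] with v hv
        using downwardContinuation_of_im_neg hh hrec hv
  intro w
  obtain ⟨n, hn⟩ := exists_nat_gt (-w.im / h)
  refine hlevel n w ?_
  rw [div_lt_iff₀ hh] at hn
  linarith

theorem exists_entire_of_continuation_across_real (hh : 0 < h) {f q : ℂ → ℂ}
    (hf : ∀ w : ℂ, w.im ≠ 0 → DifferentiableAt ℂ f w)
    (hq : ∀ w : ℂ, w.im < 0 → DifferentiableAt ℂ q w)
    (hloc : ∀ x : ℝ, ∃ g : ℂ → ℂ, ∀ᶠ w in 𝓝 (x : ℂ), DifferentiableAt ℂ g w ∧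
      (0 < w.im → g w = f w) ∧ (w.im < 0 → g w = f w + q w * f (w + h * Complex.I))) :
    ∃ F : ℂ → ℂ, Differentiable ℂ F ∧ ∀ w, 0 < w.im → F w = f w := by
  classical
  let f' : ℂ → ℂ := fun w => if 0 < w.im then f w else f w + q w * f (w + h * Complex.I)
  have hpos : ∀ w : ℂ, 0 < w.im → f' w = f w := fun w hw => if_pos hw
  have hneg : ∀ w : ℂ, w.im < 0 → f' w = f w + q w * f (w + h * Complex.I) :=
    fun w hw => if_neg hw.not_gt
  have hglue : ∀ w : ℂ, -h < w.im → ∃ g : ℂ → ℂ, ∀ᶠ v in 𝓝 w, DifferentiableAt ℂ g v ∧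
      (v.im ≠ 0 → g v = f' v) := by
    intro w hw
    rcases lt_trichotomy w.im 0 with hw0 | hw0 | hw0
    · refine ⟨fun v => f v + q v * f (v + h * Complex.I), ?_⟩
      filter_upwards [Complex.continuous_im.continuousAt.eventually_lt_const hw0,
        Complex.continuous_im.continuousAt.eventually_const_lt hw] with v hv0 hv
      have hvh : (v + h * Complex.I).im ≠ 0 := by simpa using by linarith
      exact ⟨(hf v hv0.ne).add ((hq v hv0).mul (differentiableAt_comp_add_const.2 (hf _ hvh))),
        fun _ => (hneg v hv0).symm⟩
    · obtain ⟨g, hg⟩ := hloc w.re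
      rw [show ((w.re : ℝ) : ℂ) = w from Complex.ext rfl hw0.symm] at hg
      refine ⟨g, hg.mono fun v hv => ⟨hv.1, fun hv0 => ?_⟩⟩
      rcases hv0.lt_or_gt with hv0 | hv0
      · rw [hneg v hv0, hv.2.2 hv0]
      · rw [hpos v hv0, hv.2.1 hv0]
    · refine ⟨f, ?_⟩
      filter_upwards [Complex.continuous_im.continuousAt.eventually_const_lt hw0] with v hv
        using ⟨hf v hv.ne', fun _ => (hpos v hv).symm⟩
  have hH := fun w hw => differentiableAt_extendFrom dense_im_ne_zero (hglue w hw)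
  refine ⟨downwardContinuation h f q (extendFrom {w : ℂ | w.im ≠ 0} f'),
    differentiable_downwardContinuation hh (fun w hw => hf w hw.ne) hq (fun w hw => (hH w hw).1)
      fun w hw hw0 => ?_, fun w hw => ?_⟩
  · have him : 0 < (w + h * Complex.I).im := by simpa using by linarith
    rw [(hH w hw).2 hw0.ne, (hH _ (by linarith)).2 him.ne', hneg w hw0, hpos _ him]
  · rw [downwardContinuation_of_neg_lt_im hh (by linarith), (hH w (by linarith)).2 hw.ne',
      hpos w hw]

end DownwardContinuation

section GammaBounds

variable {s : ℂ}

theorem norm_Gamma_le_Gamma_re (hs : 0 < s.re) : ‖Complex.Gamma s‖ ≤ Real.Gamma s.re := by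
  rw [Complex.Gamma_eq_integral hs, Real.Gamma_eq_integral hs, Complex.GammaIntegral]
  refine (norm_integral_le_integral_norm _).trans_eq (setIntegral_congr_fun measurableSet_Ioi ?_)
  intro x hx
  simp only [norm_mul, Complex.norm_cpow_eq_rpow_re_of_pos hx, Complex.norm_real, Real.norm_eq_abs,
    Real.abs_exp, Complex.sub_re, Complex.one_re]

theorem norm_Gamma_sq_of_re_eq_half (hs : s.re = 1 / 2) :
    ‖Complex.Gamma s‖ ^ 2 = Real.pi / Real.cosh (Real.pi * s.im) := by
  have hconj : 1 - s = starRingEnd ℂ s := by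
    refine Complex.ext ?_ (by simp)
    rw [Complex.sub_re, Complex.one_re, Complex.conj_re, hs]
    norm_num
  have hsin : Complex.sin (Real.pi * s) = (Real.cosh (Real.pi * s.im) : ℂ) := by
    have : (Real.pi : ℂ) * s = Real.pi / 2 - -((Real.pi * s.im : ℝ) : ℂ) * Complex.I := by
      refine Complex.ext (by simp [hs, div_eq_mul_inv]) (by simp)
    rw [this, Complex.sin_pi_div_two_sub, Complex.cos_mul_I, Complex.cosh_neg, Complex.ofReal_cosh]
  have hreflection := Complex.Gamma_mul_Gamma_one_sub s
  rw [hconj, Complex.Gamma_conj, Complex.mul_conj, Complex.normSq_eq_norm_sq, hsin] at hreflection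
  exact_mod_cast hreflection

theorem norm_Gamma_mul_exp_le_of_re_eq_half (hs : s.re = 1 / 2) :
    ‖Complex.Gamma s‖ * Real.exp (Real.pi / 2 * |s.im|) ≤ 3 := by
  have hcosh : Real.exp (Real.pi * |s.im|) ≤ 2 * Real.cosh (Real.pi * s.im) := by
    rw [← Real.cosh_abs, abs_mul, abs_of_pos Real.pi_pos, Real.cosh_eq]
    linarith [Real.exp_pos (-(Real.pi * |s.im|))]
  refine abs_le_of_sq_le_sq' ?_ (by norm_num) |>.2
  calc (‖Complex.Gamma s‖ * Real.exp (Real.pi / 2 * |s.im|)) ^ 2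
      = Real.pi / Real.cosh (Real.pi * s.im) * Real.exp (Real.pi * |s.im|) := by
        rw [mul_pow, norm_Gamma_sq_of_re_eq_half hs, ← Real.exp_nat_mul]
        ring_nf
    _ ≤ Real.pi / Real.cosh (Real.pi * s.im) * (2 * Real.cosh (Real.pi * s.im)) := by
        have := Real.cosh_pos (Real.pi * s.im)
        have := Real.pi_pos
        gcongr
    _ = 2 * Real.pi := by
        have := (Real.cosh_pos (Real.pi * s.im)).ne'
        field_simp
    _ ≤ 3 ^ 2 := by linarith [Real.pi_lt_four]

theorem im_mul_arg_le (hs : 0 ≤ s.re) : s.im * s.arg ≤ Real.pi / 2 * |s.im| :=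
  calc s.im * s.arg ≤ |s.arg| * |s.im| := by
        rw [← abs_mul, mul_comm]
        exact le_abs_self _
    _ ≤ Real.pi / 2 * |s.im| := by
        gcongr
        exact Complex.abs_arg_le_pi_div_two_iff.2 hs

theorem pi_div_two_sub_mul_sin_le_cos {x : ℝ} (h0 : 0 ≤ x) (h1 : x < Real.pi / 2) :
    (Real.pi / 2 - x) * Real.sin x ≤ Real.cos x := by
  rcases h0.eq_or_lt with rfl | hx
  · simp
  · have h := Real.le_tan (x := Real.pi / 2 - x) (by linarith) (by linarith)
    rwa [Real.tan_pi_div_two_sub, Real.tan_eq_sin_div_cos, inv_div,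
      le_div_iff₀ (Real.sin_pos_of_pos_of_lt_pi hx (by linarith))] at h

theorem pi_div_two_mul_abs_im_sub_re_le (hs : 0 < s.re) :
    Real.pi / 2 * |s.im| - s.re ≤ s.im * s.arg := by
  have hlt : |s.arg| < Real.pi / 2 := Complex.abs_arg_lt_pi_div_two_iff.2 (Or.inl hs)
  have hsin : ‖s‖ * Real.sin |s.arg| = |s.im| := by
    rw [← Complex.norm_mul_sin_arg s, abs_mul, abs_norm,
      Real.abs_sin_eq_sin_abs_of_abs_le_pi (by linarith [Real.pi_pos])]
  have hcos : ‖s‖ * Real.cos |s.arg| = s.re := by rw [Real.cos_abs, Complex.norm_mul_cos_arg]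
  have hsame_sign : s.im * s.arg = |s.im| * |s.arg| := by
    rw [← abs_mul, abs_of_nonneg]
    rcases le_total 0 s.arg with h | h
    · exact mul_nonneg (Complex.arg_nonneg_iff.1 h) h
    · refine mul_nonneg_of_nonpos_of_nonpos ?_ h
      rw [← Complex.norm_mul_sin_arg s]
      exact mul_nonpos_of_nonneg_of_nonpos (norm_nonneg s)
        (Real.sin_nonpos_of_nonpos_of_neg_pi_le h (Complex.neg_pi_lt_arg s).le)
  have h := mul_le_mul_of_nonneg_left (pi_div_two_sub_mul_sin_le_cos (abs_nonneg s.arg) hlt)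
    (norm_nonneg s)
  rw [hcos, mul_left_comm, hsin] at h
  rw [hsame_sign]
  linarith

/-- `Γ(s) / s^(s - 1/2)`; by Stirling's formula it has the size of `e^(-s)`, so that it is bounded
in vertical strips to the right of the imaginary axis. -/
noncomputable def normalizedGamma (s : ℂ) : ℂ :=
  Complex.Gamma s * Complex.exp ((1 / 2 - s) * Complex.log s)

theorem norm_normalizedGamma (hs : s ≠ 0) :
    ‖normalizedGamma s‖ = ‖Complex.Gamma s‖ * (‖s‖ ^ (1 / 2 - s.re) * Real.exp (s.im * s.arg)) := by
  rw [normalizedGamma, norm_mul, Complex.norm_exp, Real.rpow_def_of_pos (norm_pos_iff.2 hs),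
    ← Real.exp_add]
  congr 2
  have hcoef : (1 / 2 - s).re = 1 / 2 - s.re ∧ (1 / 2 - s).im = -s.im := by constructor <;> simp
  rw [Complex.mul_re, hcoef.1, hcoef.2, Complex.log_re, Complex.log_im]
  ring

theorem ne_zero_of_re_pos (hs : 0 < s.re) : s ≠ 0 := by
  rintro rfl
  simp at hs

theorem differentiableAt_Gamma_of_re_pos (hs : 0 < s.re) : DifferentiableAt ℂ Complex.Gamma s := by
  refine Complex.differentiableAt_Gamma _ fun m hm => ?_
  rw [hm] at hs
  rw [Complex.neg_re, Complex.natCast_re] at hs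
  linarith [(Nat.cast_nonneg m : (0 : ℝ) ≤ m)]

theorem differentiableAt_normalizedGamma (hs : 0 < s.re) :
    DifferentiableAt ℂ normalizedGamma s :=
  (differentiableAt_Gamma_of_re_pos hs).mul
    (((differentiableAt_id.const_sub _).mul (Complex.differentiableAt_log (Or.inl hs))).cexp)

theorem norm_normalizedGamma_le_of_re_eq_half (hs : s.re = 1 / 2) : ‖normalizedGamma s‖ ≤ 3 := by
  have hpos : 0 < s.re := by norm_num [hs]
  rw [norm_normalizedGamma (ne_zero_of_re_pos hpos), hs, sub_self, Real.rpow_zero, one_mul]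
  exact (mul_le_mul_of_nonneg_left (Real.exp_le_exp.2 (im_mul_arg_le hpos.le))
    (norm_nonneg _)).trans (norm_Gamma_mul_exp_le_of_re_eq_half hs)

theorem norm_normalizedGamma_le_of_re_eq_three_halves (hs : s.re = 3 / 2) :
    ‖normalizedGamma s‖ ≤ 3 := by
  have hpos : 0 < s.re := by norm_num [hs]
  have hre : (s - 1).re = 1 / 2 := by norm_num [hs]
  have hnorm : 0 < ‖s‖ := norm_pos_iff.2 (ne_zero_of_re_pos hpos)
  have hle : ‖s - 1‖ ≤ ‖s‖ := by
    rw [← abs_norm, ← abs_norm s, ← sq_le_sq, Complex.sq_norm, Complex.sq_norm,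
      Complex.normSq_apply, Complex.normSq_apply, hre, hs, Complex.sub_im, Complex.one_im, sub_zero]
    norm_num
  have hGamma : Complex.Gamma s = (s - 1) * Complex.Gamma (s - 1) := by
    rw [← Complex.Gamma_add_one _ (ne_zero_of_re_pos (by norm_num [hre])), sub_add_cancel]
  have hhalf := norm_Gamma_mul_exp_le_of_re_eq_half hre
  have harg := Real.exp_le_exp.2 (im_mul_arg_le hpos.le)
  rw [Complex.sub_im, Complex.one_im, sub_zero] at hhalf
  rw [norm_normalizedGamma (ne_zero_of_re_pos hpos), hs, hGamma, norm_mul,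
    show (1 / 2 - 3 / 2 : ℝ) = -1 by norm_num, Real.rpow_neg_one]
  calc ‖s - 1‖ * ‖Complex.Gamma (s - 1)‖ * (‖s‖⁻¹ * Real.exp (s.im * s.arg))
      ≤ ‖s‖ * ‖Complex.Gamma (s - 1)‖ * (‖s‖⁻¹ * Real.exp (Real.pi / 2 * |s.im|)) := by
        gcongr ?_ * _ * (_ * ?_)
    _ = ‖Complex.Gamma (s - 1)‖ * Real.exp (Real.pi / 2 * |s.im|) := by field_simp
    _ ≤ 3 := hhalf

theorem exists_norm_normalizedGamma_le_exp : ∃ M : ℝ, ∀ s : ℂ, 1 / 2 ≤ s.re → s.re ≤ 3 / 2 →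
    ‖normalizedGamma s‖ ≤ M * Real.exp (Real.pi / 2 * |s.im|) := by
  have hcont : ContinuousOn Real.Gamma (Icc (1 / 2) (3 / 2)) := fun x hx =>
    (Real.differentiableAt_Gamma fun m hm => by
      linarith [hx.1, (Nat.cast_nonneg m : (0 : ℝ) ≤ m)]).continuousAt.continuousWithinAt
  obtain ⟨M, hM⟩ := isCompact_Icc.exists_bound_of_continuousOn hcont
  refine ⟨M * 2, fun s h₁ h₂ => ?_⟩
  have hpos : 0 < s.re := by linarith
  have hnorm : 1 / 2 ≤ ‖s‖ := h₁.trans (Complex.re_le_norm s)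
  have hGamma : ‖Complex.Gamma s‖ ≤ M :=
    (norm_Gamma_le_Gamma_re hpos).trans ((le_abs_self _).trans (hM s.re ⟨h₁, h₂⟩))
  have hpow : ‖s‖ ^ (1 / 2 - s.re) ≤ 2 :=
    calc ‖s‖ ^ (1 / 2 - s.re) ≤ (1 / 2 : ℝ) ^ (1 / 2 - s.re) :=
          Real.rpow_le_rpow_of_nonpos (by norm_num) hnorm (by linarith)
      _ ≤ (1 / 2 : ℝ) ^ (-1 : ℝ) :=
          Real.rpow_le_rpow_of_exponent_ge (by norm_num) (by norm_num) (by linarith)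
      _ = 2 := by norm_num [Real.rpow_neg_one]
  rw [norm_normalizedGamma (ne_zero_of_re_pos hpos), mul_assoc]
  gcongr ?_ * (?_ * ?_)
  · exact (norm_nonneg _).trans hGamma
  · exact Real.exp_le_exp.2 (im_mul_arg_le hpos.le)

theorem norm_normalizedGamma_le (h₁ : 1 / 2 ≤ s.re) (h₂ : s.re ≤ 3 / 2) :
    ‖normalizedGamma s‖ ≤ 3 := by
  refine PhragmenLindelof.vertical_strip (a := 1 / 2) (b := 3 / 2)
    (DifferentiableOn.diffContOnCl fun z hz => ?_)
    ⟨1, by rw [lt_div_iff₀ (by norm_num)]; linarith [Real.pi_gt_three], Real.pi / 2, ?_⟩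
    (fun z => norm_normalizedGamma_le_of_re_eq_half)
    (fun z => norm_normalizedGamma_le_of_re_eq_three_halves) h₁ h₂
  · have hre : 1 / 2 ≤ z.re := closure_minimal (fun w hw => hw.1.le)
      (isClosed_le continuous_const Complex.continuous_re) hz
    exact (differentiableAt_normalizedGamma (by linarith)).differentiableWithinAt
  · obtain ⟨M, hM⟩ := exists_norm_normalizedGamma_le_exp
    refine Asymptotics.IsBigO.of_bound |M| (mem_inf_of_right fun z hz => ?_)
    refine (hM z hz.1.le hz.2.le).trans ?_
    rw [Real.norm_of_nonneg (Real.exp_pos _).le]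
    gcongr ?_ * Real.exp (_ * ?_)
    · exact le_abs_self M
    · linarith [Real.add_one_le_exp (1 * |z.im|)]

/-- The size `|Im s|^(Re s - 1/2) e^(-π|Im s|/2)` of `Γ(s)` in vertical strips, away from the real
axis, according to Stirling's formula. -/
noncomputable def stirlingProfile (s : ℂ) : ℝ :=
  |s.im| ^ (s.re - 1 / 2) * Real.exp (-(Real.pi / 2 * |s.im|))

theorem stirlingProfile_pos (hs : s.im ≠ 0) : 0 < stirlingProfile s :=
  mul_pos (Real.rpow_pos_of_pos (abs_pos.2 hs) _) (Real.exp_pos _)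

theorem stirlingProfile_add_one (hs : s.im ≠ 0) :
    stirlingProfile (s + 1) = |s.im| * stirlingProfile s := by
  simp only [stirlingProfile, Complex.add_im, Complex.one_im, add_zero, Complex.add_re,
    Complex.one_re]
  rw [add_sub_right_comm, Real.rpow_add_one (abs_pos.2 hs).ne']
  ring

theorem stirlingProfile_mul_one_sub (hs : s.im ≠ 0) :
    stirlingProfile s * stirlingProfile (1 - s) = Real.exp (-(Real.pi * |s.im|)) := by
  simp only [stirlingProfile, Complex.sub_im, Complex.one_im, zero_sub, abs_neg, Complex.sub_re,
    Complex.one_re]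
  rw [mul_mul_mul_comm, ← Real.rpow_add (abs_pos.2 hs), ← Real.exp_add]
  ring_nf
  rw [Real.rpow_zero, one_mul]

theorem norm_le_add_mul_abs_im {a : ℝ} (hre : |s.re| ≤ a) (him : 1 ≤ |s.im|) :
    ‖s‖ ≤ (a + 1) * |s.im| := by
  have ha : 0 ≤ a := (abs_nonneg _).trans hre
  nlinarith [Complex.norm_le_abs_re_add_abs_im s]

theorem norm_Gamma_le_stirlingProfile (h₁ : 1 / 2 ≤ s.re) (h₂ : s.re ≤ 3 / 2)
    (him : 1 ≤ |s.im|) :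
    ‖Complex.Gamma s‖ ≤ 3 * (5 / 2 * Real.exp (3 / 2)) * stirlingProfile s := by
  have hpos : 0 < s.re := by linarith
  have him0 : 0 < |s.im| := by linarith
  have hnorm : 0 < ‖s‖ := norm_pos_iff.2 (ne_zero_of_re_pos hpos)
  have hpow : ‖s‖ ^ (s.re - 1 / 2) ≤ 5 / 2 * |s.im| ^ (s.re - 1 / 2) :=
    calc ‖s‖ ^ (s.re - 1 / 2) ≤ (5 / 2 * |s.im|) ^ (s.re - 1 / 2) := by
          gcongr
          linarith [norm_le_add_mul_abs_im (abs_le.2 ⟨by linarith, h₂⟩) him]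
      _ = (5 / 2) ^ (s.re - 1 / 2) * |s.im| ^ (s.re - 1 / 2) :=
          Real.mul_rpow (by norm_num) him0.le
      _ ≤ 5 / 2 * |s.im| ^ (s.re - 1 / 2) := by
          gcongr
          exact Real.rpow_le_self_of_one_le (by norm_num) (by linarith)
  have hexp : Real.exp (-(s.im * s.arg)) ≤
      Real.exp (3 / 2) * Real.exp (-(Real.pi / 2 * |s.im|)) := by
    rw [← Real.exp_add, Real.exp_le_exp]
    linarith [pi_div_two_mul_abs_im_sub_re_le hpos]
  have hGamma : ‖Complex.Gamma s‖ =
      ‖normalizedGamma s‖ * (‖s‖ ^ (s.re - 1 / 2) * Real.exp (-(s.im * s.arg))) := by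
    rw [norm_normalizedGamma (ne_zero_of_re_pos hpos), ← neg_sub s.re, Real.rpow_neg hnorm.le,
      Real.exp_neg]
    have := (Real.rpow_pos_of_pos hnorm (s.re - 1 / 2)).ne'
    field_simp
  calc ‖Complex.Gamma s‖
      ≤ 3 * (5 / 2 * |s.im| ^ (s.re - 1 / 2) *
          (Real.exp (3 / 2) * Real.exp (-(Real.pi / 2 * |s.im|)))) := by
        rw [hGamma]
        gcongr ?_ * (?_ * ?_)
        exact norm_normalizedGamma_le h₁ h₂
    _ = 3 * (5 / 2 * Real.exp (3 / 2)) * stirlingProfile s := by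
        rw [stirlingProfile]
        ring

theorem norm_Gamma_le_of_norm_Gamma_add_one_le {C : ℝ} (him : s.im ≠ 0)
    (h : ‖Complex.Gamma (s + 1)‖ ≤ C * stirlingProfile (s + 1)) :
    ‖Complex.Gamma s‖ ≤ C * stirlingProfile s := by
  have hs : s ≠ 0 := fun h0 => him (by rw [h0, Complex.zero_im])
  rw [Complex.Gamma_add_one s hs, stirlingProfile_add_one him, norm_mul, mul_left_comm] at h
  refine le_of_mul_le_mul_left ?_ (abs_pos.2 him)
  exact (mul_le_mul_of_nonneg_right (Complex.abs_im_le_norm s) (norm_nonneg _)).trans h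

theorem norm_Gamma_add_one_le {a C : ℝ} (hre : |s.re| ≤ a) (him : 1 ≤ |s.im|)
    (h : ‖Complex.Gamma s‖ ≤ C * stirlingProfile s) :
    ‖Complex.Gamma (s + 1)‖ ≤ (a + 1) * C * stirlingProfile (s + 1) := by
  have him0 : s.im ≠ 0 := fun h => by norm_num [h] at him
  have hs : s ≠ 0 := fun h0 => him0 (by rw [h0, Complex.zero_im])
  calc ‖Complex.Gamma (s + 1)‖ = ‖s‖ * ‖Complex.Gamma s‖ := by
        rw [Complex.Gamma_add_one s hs, norm_mul]
    _ ≤ (a + 1) * |s.im| * (C * stirlingProfile s) := by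
        gcongr
        · exact (norm_nonneg s).trans (norm_le_add_mul_abs_im hre him)
        · exact norm_le_add_mul_abs_im hre him
    _ = (a + 1) * C * stirlingProfile (s + 1) := by
        rw [stirlingProfile_add_one him0]
        ring

theorem exists_norm_Gamma_le_stirlingProfile_of_nat (n : ℕ) : ∃ C : ℝ, ∀ s : ℂ,
    1 / 2 - n ≤ s.re → s.re ≤ 3 / 2 + n → 1 ≤ |s.im| →
      ‖Complex.Gamma s‖ ≤ C * stirlingProfile s := by
  induction n with
  | zero =>
    exact ⟨_, fun s h₁ h₂ => norm_Gamma_le_stirlingProfile (by simpa using h₁) (by simpa using h₂)⟩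
  | succ n ih =>
    obtain ⟨C, hC⟩ := ih
    refine ⟨max C ((n + 3 / 2 + 1) * C), fun s h₁ h₂ him => ?_⟩
    push_cast at h₁ h₂
    have him0 : s.im ≠ 0 := fun h => by norm_num [h] at him
    have hprofile := (stirlingProfile_pos him0).le
    by_cases hright : s.re ≤ 3 / 2 + n
    · refine le_trans ?_ (mul_le_mul_of_nonneg_right (le_max_left _ _) hprofile)
      by_cases hleft : 1 / 2 - n ≤ s.re
      · exact hC s hleft hright him
      · refine norm_Gamma_le_of_norm_Gamma_add_one_le him0 (hC (s + 1) ?_ ?_ (by simpa using him))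
        all_goals
          simp only [Complex.add_re, Complex.one_re]
          linarith
    · refine le_trans ?_ (mul_le_mul_of_nonneg_right (le_max_right _ _) hprofile)
      have him' : 1 ≤ |(s - 1).im| := by simpa using him
      have hre' : (s - 1).re = s.re - 1 := by simp
      have h := hC (s - 1) (by linarith) (by linarith) him'
      simpa only [sub_add_cancel] using
        norm_Gamma_add_one_le (abs_le.2 ⟨by linarith, by linarith⟩) him' h

theorem exists_norm_Gamma_le_stirlingProfile (a b : ℝ) : ∃ C : ℝ, ∀ s : ℂ,
    a ≤ s.re → s.re ≤ b → 1 ≤ |s.im| → ‖Complex.Gamma s‖ ≤ C * stirlingProfile s := by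
  obtain ⟨n, hn⟩ := exists_nat_ge (max (1 / 2 - a) (b - 3 / 2))
  obtain ⟨C, hC⟩ := exists_norm_Gamma_le_stirlingProfile_of_nat n
  obtain ⟨hna, hnb⟩ := max_le_iff.1 hn
  exact ⟨C, fun s h₁ h₂ => hC s (by linarith) (by linarith)⟩

theorem norm_sin_le_exp_abs_im (s : ℂ) : ‖Complex.sin s‖ ≤ Real.exp |s.im| := by
  have hexp : ∀ w : ℂ, |w.re| = |s.im| → ‖Complex.exp w‖ ≤ Real.exp |s.im| := fun w hw => by
    rw [Complex.norm_exp, Real.exp_le_exp, ← hw]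
    exact le_abs_self _
  calc ‖Complex.sin s‖ = ‖Complex.exp (-s * Complex.I) - Complex.exp (s * Complex.I)‖ / 2 := by
        rw [Complex.sin, norm_div, norm_mul, Complex.norm_I, mul_one, Complex.norm_ofNat]
    _ ≤ (Real.exp |s.im| + Real.exp |s.im|) / 2 := by
        gcongr
        exact (norm_sub_le _ _).trans (add_le_add (hexp _ (by simp)) (hexp _ (by simp)))
    _ = Real.exp |s.im| := by ring

theorem Gamma_ne_zero_of_im_ne_zero (hs : s.im ≠ 0) : Complex.Gamma s ≠ 0 :=
  Complex.Gamma_ne_zero fun m h => hs (by rw [h, Complex.neg_im, Complex.natCast_im, neg_zero])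

theorem inv_Gamma_eq_of_im_ne_zero (hs : s.im ≠ 0) :
    (Complex.Gamma s)⁻¹ = Complex.Gamma (1 - s) * Complex.sin (Real.pi * s) / Real.pi := by
  have hGamma := Gamma_ne_zero_of_im_ne_zero hs
  have hGamma' : Complex.Gamma (1 - s) ≠ 0 := Gamma_ne_zero_of_im_ne_zero (by simpa using hs)
  have hreflection := Complex.Gamma_mul_Gamma_one_sub s
  have hsin : Complex.sin (Real.pi * s) ≠ 0 := fun h => by
    rw [h, div_zero] at hreflection
    exact mul_ne_zero hGamma hGamma' hreflection
  have hpi : (Real.pi : ℂ) ≠ 0 := Complex.ofReal_ne_zero.2 Real.pi_ne_zero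
  rw [eq_div_iff hpi, inv_mul_eq_iff_eq_mul₀ hGamma, ← mul_assoc, hreflection,
    div_mul_cancel₀ _ hsin]

theorem exists_norm_inv_Gamma_le_inv_stirlingProfile (a b : ℝ) : ∃ C : ℝ, ∀ s : ℂ,
    a ≤ s.re → s.re ≤ b → 1 ≤ |s.im| → ‖(Complex.Gamma s)⁻¹‖ ≤ C * (stirlingProfile s)⁻¹ := by
  obtain ⟨C, hC⟩ := exists_norm_Gamma_le_stirlingProfile (1 - b) (1 - a)
  refine ⟨C / Real.pi, fun s h₁ h₂ him => ?_⟩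
  have him0 : s.im ≠ 0 := fun h => by norm_num [h] at him
  have hprofile := (stirlingProfile_pos him0).ne'
  have hGamma : ‖Complex.Gamma (1 - s)‖ ≤ C * stirlingProfile (1 - s) := by
    refine hC (1 - s) ?_ ?_ (by simpa using him)
    all_goals
      simp only [Complex.sub_re, Complex.one_re]
      linarith
  have hsin : ‖Complex.sin (Real.pi * s)‖ ≤ Real.exp (Real.pi * |s.im|) := by
    simpa [abs_mul, abs_of_pos Real.pi_pos] using norm_sin_le_exp_abs_im (Real.pi * s)
  calc ‖(Complex.Gamma s)⁻¹‖
      = ‖Complex.Gamma (1 - s)‖ * ‖Complex.sin (Real.pi * s)‖ / Real.pi := by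
        rw [inv_Gamma_eq_of_im_ne_zero him0, norm_div, norm_mul, Complex.norm_real,
          Real.norm_of_nonneg Real.pi_pos.le]
    _ ≤ C * stirlingProfile (1 - s) * Real.exp (Real.pi * |s.im|) / Real.pi := by
        gcongr
        exact (norm_nonneg _).trans hGamma
    _ = C / Real.pi * (stirlingProfile s)⁻¹ := by
        rw [show Real.exp (Real.pi * |s.im|) = (stirlingProfile s * stirlingProfile (1 - s))⁻¹ by
          rw [stirlingProfile_mul_one_sub him0, Real.exp_neg, inv_inv]]
        have := (stirlingProfile_pos (s := 1 - s) (by simpa using him0)).ne'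
        field_simp

end GammaBounds

section StripAsymptotics

open Asymptotics

theorem isBigO_norm_rpow_of_isTheta {α E F : Type*} [SeminormedAddCommGroup E]
    [SeminormedAddCommGroup F] {l : Filter α} {f : α → E} {g : α → F} {e : α → ℝ} {B : ℝ}
    (hfg : f =Θ[l] g) (he : ∀ᶠ x in l, |e x| ≤ B) :
    (fun x => ‖f x‖ ^ e x) =O[l] fun x => ‖g x‖ ^ e x := by
  obtain ⟨C, hC⟩ := hfg.1.bound
  obtain ⟨D, hD⟩ := hfg.2.bound
  set K := max 1 (max C D)
  have hK : 1 ≤ K := le_max_left _ _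
  have hK0 : 0 < K := by linarith
  refine IsBigO.of_bound (K ^ B) ?_
  filter_upwards [hC, hD, he] with x hCx hDx hex
  have hfK : ‖f x‖ ≤ K * ‖g x‖ := hCx.trans (by gcongr; simp [K])
  have hgK : ‖g x‖ ≤ K * ‖f x‖ := hDx.trans (by gcongr; simp [K])
  rw [Real.norm_of_nonneg (Real.rpow_nonneg (norm_nonneg _) _),
    Real.norm_of_nonneg (Real.rpow_nonneg (norm_nonneg _) _)]
  rcases le_total 0 (e x) with h | h
  · calc ‖f x‖ ^ e x ≤ (K * ‖g x‖) ^ e x := by gcongr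
      _ = K ^ e x * ‖g x‖ ^ e x := Real.mul_rpow hK0.le (norm_nonneg _)
      _ ≤ K ^ B * ‖g x‖ ^ e x := by
        gcongr
        exact (le_abs_self _).trans hex
  · rcases (norm_nonneg (g x)).eq_or_lt with hg | hg
    · rw [← hg, mul_zero] at hfK
      rw [← hg, le_antisymm hfK (norm_nonneg _)]
      exact le_mul_of_one_le_left (Real.rpow_nonneg le_rfl _)
        (Real.one_le_rpow hK ((abs_nonneg _).trans hex))
    · calc ‖f x‖ ^ e x ≤ (‖g x‖ / K) ^ e x :=
            Real.rpow_le_rpow_of_nonpos (by positivity) ((div_le_iff₀' hK0).2 hgK) h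
        _ = K ^ (-e x) * ‖g x‖ ^ e x := by
            rw [Real.div_rpow hg.le hK0.le, Real.rpow_neg hK0.le, div_eq_inv_mul]
        _ ≤ K ^ B * ‖g x‖ ^ e x := by
            gcongr
            exact (neg_le_abs _).trans hex

variable {h : ℝ}

theorem tendsto_abs_re_stripEnds (h : ℝ) : Tendsto (fun z : ℂ => |z.re|) (stripEnds h) atTop :=
  tendsto_comap.mono_left inf_le_left

theorem eventually_abs_im_le_stripEnds (h : ℝ) : ∀ᶠ z : ℂ in stripEnds h, |z.im| ≤ h / 2 :=
  mem_inf_of_right (mem_principal_self _)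

theorem tendsto_conj_stripEnds (h : ℝ) :
    Tendsto (starRingEnd ℂ) (stripEnds h) (stripEnds h) := by
  refine tendsto_inf.2 ⟨tendsto_comap_iff.2 ?_, tendsto_principal.2 ?_⟩
  · simpa only [Function.comp_def, Complex.conj_re] using tendsto_abs_re_stripEnds h
  · filter_upwards [eventually_abs_im_le_stripEnds h] with z hz
    simpa only [mem_ofPred_eq, Complex.conj_im, abs_neg] using hz

theorem isTheta_re_stripEnds (h : ℝ) : (fun z : ℂ => z.re) =Θ[stripEnds h] fun z => z := by
  refine ⟨isBigO_of_le _ Complex.abs_re_le_norm, IsBigO.of_bound 2 ?_⟩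
  filter_upwards [(tendsto_abs_re_stripEnds h).eventually_ge_atTop (h / 2),
    eventually_abs_im_le_stripEnds h] with z hre him
  rw [Real.norm_eq_abs]
  linarith [Complex.norm_le_abs_re_add_abs_im z]

theorem isTheta_re_sub_stripEnds (h x : ℝ) :
    (fun z : ℂ => z.re - x) =Θ[stripEnds h] fun z => z := by
  have hconst : (fun _ : ℂ => x) =o[stripEnds h] fun z => z.re :=
    isLittleO_const_left.2 (Or.inr (tendsto_abs_re_stripEnds h))
  exact (IsEquivalent.refl.sub_isLittleO hconst).isTheta.trans (isTheta_re_stripEnds h)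

theorem re_one_sub_I_mul_div (z d : ℂ) (h : ℝ) :
    (1 - Complex.I * (z - d) / h).re = 1 + (z.im - d.im) / h := by
  simp only [Complex.sub_re, Complex.one_re, Complex.div_ofReal_re, Complex.I_mul_re,
    Complex.sub_im]
  ring

theorem im_one_sub_I_mul_div (z d : ℂ) (h : ℝ) :
    (1 - Complex.I * (z - d) / h).im = -((z.re - d.re) / h) := by
  simp [Complex.div_ofReal_im]

theorem isTheta_im_one_sub_I_mul_div (hh : h ≠ 0) (d : ℂ) :
    (fun z : ℂ => (1 - Complex.I * (z - d) / h).im) =Θ[stripEnds h] fun z => z := by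
  have him : (fun z : ℂ => (1 - Complex.I * (z - d) / h).im) =
      fun z => -h⁻¹ * (z.re - d.re) := by
    funext z
    rw [im_one_sub_I_mul_div]
    ring
  rw [him]
  exact (isTheta_const_mul_left (neg_ne_zero.2 (inv_ne_zero hh))).2 (isTheta_re_sub_stripEnds h _)

theorem eventually_abs_im_sub_div_le_stripEnds (hh : 0 < h) (d : ℂ) :
    ∀ᶠ z : ℂ in stripEnds h, |(z.im - d.im) / h| ≤ (h / 2 + |d.im|) / h := by
  filter_upwards [eventually_abs_im_le_stripEnds h] with z hz
  rw [abs_div, abs_of_pos hh]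
  gcongr
  exact (abs_sub _ _).trans (by gcongr)

theorem isBigO_inv_Gamma_inv_stirlingProfile (hh : 0 < h) (d : ℂ) :
    (fun z : ℂ => (Complex.Gamma (1 - Complex.I * (z - d) / h))⁻¹) =O[stripEnds h]
      fun z => (stirlingProfile (1 - Complex.I * (z - d) / h))⁻¹ := by
  obtain ⟨C, hC⟩ := exists_norm_inv_Gamma_le_inv_stirlingProfile
    (1 - (h / 2 + |d.im|) / h) (1 + (h / 2 + |d.im|) / h)
  refine IsBigO.of_bound C ?_
  have him : Tendsto (fun z : ℂ => |(1 - Complex.I * (z - d) / h).im|) (stripEnds h) atTop :=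
    ((isTheta_im_one_sub_I_mul_div hh.ne' d).trans
      (isTheta_re_stripEnds h).symm).tendsto_norm_atTop_iff.2 (tendsto_abs_re_stripEnds h)
  filter_upwards [eventually_abs_im_sub_div_le_stripEnds hh d, him.eventually_ge_atTop 1]
    with z hz him
  have him0 : (1 - Complex.I * (z - d) / h).im ≠ 0 := fun h0 => by norm_num [h0] at him
  rw [Real.norm_of_nonneg (inv_nonneg.2 (stirlingProfile_pos him0).le)]
  refine hC _ ?_ ?_ him
  all_goals
    rw [re_one_sub_I_mul_div]
    linarith [abs_le.1 hz]

theorem isBigO_exp_abs_im_one_sub_I_mul_div (hh : 0 < h) (d : ℂ) (l : Filter ℂ) :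
    (fun z : ℂ => Real.exp (Real.pi / 2 * |(1 - Complex.I * (z - d) / h).im|)) =O[l]
      fun z => Real.exp (Real.pi / (2 * h) * |z.re|) := by
  refine IsBigO.of_bound (Real.exp (Real.pi / (2 * h) * |d.re|)) (Eventually.of_forall fun z => ?_)
  rw [Real.norm_of_nonneg (Real.exp_pos _).le, Real.norm_of_nonneg (Real.exp_pos _).le,
    ← Real.exp_add, Real.exp_le_exp, im_one_sub_I_mul_div, abs_neg, abs_div, abs_of_pos hh]
  calc Real.pi / 2 * (|z.re - d.re| / h) ≤ Real.pi / 2 * ((|z.re| + |d.re|) / h) := by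
        gcongr
        exact abs_sub _ _
    _ = Real.pi / (2 * h) * |d.re| + Real.pi / (2 * h) * |z.re| := by ring

theorem isBigO_inv_Gamma_stripEnds (hh : 0 < h) (d : ℂ) :
    (fun z : ℂ => (Complex.Gamma (1 - Complex.I * (z - d) / h))⁻¹) =O[stripEnds h]
      fun z : ℂ => Real.exp (Real.pi / (2 * h) * |z.re|) *
        ‖z‖ ^ (-(1 / 2) - (z.im - d.im) / h) := by
  have hpow : (fun z : ℂ => |(1 - Complex.I * (z - d) / h).im| ^ (-(1 / 2) - (z.im - d.im) / h))
      =O[stripEnds h] fun z : ℂ => ‖z‖ ^ (-(1 / 2) - (z.im - d.im) / h) :=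
    isBigO_norm_rpow_of_isTheta (B := 1 / 2 + (h / 2 + |d.im|) / h)
      (isTheta_im_one_sub_I_mul_div hh.ne' d) <| by
        filter_upwards [eventually_abs_im_sub_div_le_stripEnds hh d] with z hz
        refine (abs_sub _ _).trans (add_le_add ?_ hz)
        norm_num [abs_of_pos]
  refine (isBigO_inv_Gamma_inv_stirlingProfile hh d).trans
    (((isBigO_exp_abs_im_one_sub_I_mul_div hh d _).mul hpow).congr_left fun z => ?_)
  rw [stirlingProfile, mul_inv, ← Real.exp_neg, neg_neg, ← Real.rpow_neg (abs_nonneg _),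
    re_one_sub_I_mul_div, mul_comm]
  congr 2
  ring

/-- The entire function `∏ₖ 1 / Γ(1 - i(z - δₖ)/h)`. -/
noncomputable def gammaProd {N : ℕ} (h : ℝ) (δ : Fin N → ℂ) (z : ℂ) : ℂ :=
  ∏ k, (Complex.Gamma (1 - Complex.I * (z - δ k) / h))⁻¹

theorem SelfConjugate.sum_im_eq_zero {N : ℕ} {δ : Fin N → ℂ} (hδ : SelfConjugate δ) :
    ∑ k, (δ k).im = 0 := by
  obtain ⟨σ, hσ⟩ := hδ
  have hneg : ∑ k, (δ k).im = -∑ k, (δ k).im :=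
    calc ∑ k, (δ k).im = ∑ k, (δ (σ k)).im := (Equiv.sum_comp σ fun k => (δ k).im).symm
      _ = -∑ k, (δ k).im := by
        simp only [← hσ, Complex.conj_im, Finset.sum_neg_distrib]
  linarith

theorem isBigO_gammaProd_stripEnds {N : ℕ} {δ : Fin N → ℂ} (hh : 0 < h) (hδ : SelfConjugate δ) :
    gammaProd h δ =O[stripEnds h] fun z : ℂ => Real.exp (N * Real.pi / (2 * h) * |z.re|) *
      ‖z‖ ^ ((N : ℝ) / (2 * h) * (-2 * z.im - h)) := by
  refine (IsBigO.finsetProd (s := Finset.univ) fun k _ =>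
    isBigO_inv_Gamma_stripEnds hh (δ k)).congr' EventuallyEq.rfl ?_
  have hexponent : ∀ z : ℂ, ∑ k, (-(1 / 2) - (z.im - (δ k).im) / h) =
      (N : ℝ) / (2 * h) * (-2 * z.im - h) := fun z => by
    rw [Finset.sum_sub_distrib, ← Finset.sum_div, Finset.sum_sub_distrib, hδ.sum_im_eq_zero]
    simp only [Finset.sum_const, Finset.card_univ, Fintype.card_fin, nsmul_eq_mul]
    field_simp
    ring
  filter_upwards [(tendsto_abs_re_stripEnds h).eventually_gt_atTop 0] with z hz
  rw [Finset.prod_mul_distrib, ← Real.exp_sum,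
    ← Real.rpow_sum_of_pos (hz.trans_le (Complex.abs_re_le_norm z)), hexponent, Finset.sum_const,
    Finset.card_univ, Fintype.card_fin, nsmul_eq_mul]
  ring_nf

theorem isBigO_exp_I_mul_stripEnds (t h : ℝ) :
    (fun z : ℂ => Complex.exp (Complex.I * t * z)) =O[stripEnds h] fun _ => (1 : ℝ) := by
  refine IsBigO.of_bound (Real.exp (|t| * (h / 2))) ?_
  filter_upwards [eventually_abs_im_le_stripEnds h] with z hz
  rw [Complex.norm_exp, norm_one, mul_one, Real.exp_le_exp]
  calc (Complex.I * t * z).re = -(t * z.im) := by simp [Complex.mul_re]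
    _ ≤ |t| * |z.im| := by
      rw [← abs_mul]
      exact neg_le_abs _
    _ ≤ |t| * (h / 2) := by gcongr

end StripAsymptotics

section Vartheta

variable {N : ℕ} {δ : Fin N → ℂ} {h : ℝ}

theorem re_sub_I_mul_half (z : ℂ) (h : ℝ) : (z - Complex.I * h / 2).re = z.re := by
  simp [Complex.sub_re]

theorem im_add_I_mul_half (z : ℂ) (h : ℝ) : (z + Complex.I * h / 2).im = z.im + h / 2 := by
  simp [Complex.add_im]

theorem im_sub_I_mul_half (z : ℂ) (h : ℝ) : (z - Complex.I * h / 2).im = z.im - h / 2 := by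
  simp [Complex.sub_im]

theorem conj_add_I_mul_half (z : ℂ) (h : ℝ) :
    starRingEnd ℂ (z + Complex.I * h / 2) = starRingEnd ℂ z - Complex.I * h / 2 := by
  simp only [map_add, map_div₀, map_mul, Complex.conj_I, Complex.conj_ofReal, map_ofNat]
  ring

theorem conj_sub_I_mul_half (z : ℂ) (h : ℝ) :
    starRingEnd ℂ (z - Complex.I * h / 2) = starRingEnd ℂ z + Complex.I * h / 2 := by
  simp only [map_sub, map_div₀, map_mul, Complex.conj_I, Complex.conj_ofReal, map_ofNat]
  ring

theorem differentiable_vartheta (δ : Fin N → ℂ) : Differentiable ℂ (vartheta δ) := by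
  unfold vartheta
  fun_prop

theorem vartheta_ne_zero (hδ : ∀ k, |(δ k).im| < h / 2) {z : ℂ} (hz : h / 2 ≤ |z.im|) :
    vartheta δ z ≠ 0 := by
  refine Finset.prod_ne_zero_iff.2 fun k _ hk => (hδ k).not_ge ?_
  rwa [← sub_eq_zero.1 hk]

theorem SelfConjugate.conj_vartheta (hδ : SelfConjugate δ) (z : ℂ) :
    starRingEnd ℂ (vartheta δ z) = vartheta δ (starRingEnd ℂ z) := by
  obtain ⟨σ, hσ⟩ := hδ
  simp only [vartheta, map_prod, map_sub, hσ]
  exact Equiv.prod_comp σ fun k => starRingEnd ℂ z - δ k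

theorem SelfConjugate.vartheta_mul_vartheta (hδ : SelfConjugate δ) (h μ : ℝ) :
    vartheta δ (μ - Complex.I * h / 2) * vartheta δ (μ + Complex.I * h / 2) =
      ((‖vartheta δ (μ - Complex.I * h / 2)‖ ^ 2 : ℝ) : ℂ) := by
  rw [← Complex.conj_ofReal μ, ← conj_sub_I_mul_half, Complex.conj_ofReal, ← hδ.conj_vartheta,
    Complex.mul_conj, Complex.normSq_eq_norm_sq]

theorem exists_mul_one_add_sq_le (a : ℝ) {b : ℝ} (hb : b ≠ 0) :
    ∃ c > 0, ∀ μ : ℝ, c * (1 + μ ^ 2) ≤ (μ - a) ^ 2 + b ^ 2 := by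
  refine ⟨((1 + 2 * a ^ 2) / b ^ 2 + 2)⁻¹, by positivity, fun μ => ?_⟩
  rw [inv_mul_le_iff₀ (by positivity)]
  have hb2 : (1 + 2 * a ^ 2) / b ^ 2 * b ^ 2 = 1 + 2 * a ^ 2 := by field_simp
  have hsq : 0 ≤ (1 + 2 * a ^ 2) / b ^ 2 * (μ - a) ^ 2 := by positivity
  nlinarith [sq_nonneg (μ - 2 * a)]

theorem exists_mul_one_add_sq_le_norm_vartheta (hN : 1 ≤ N) (hδ : ∀ k, |(δ k).im| < h / 2) :
    ∃ c > 0, ∀ μ : ℝ, c * (1 + μ ^ 2) ≤ ‖vartheta δ (μ - Complex.I * h / 2)‖ ^ 2 := by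
  have hb : ∀ k, h / 2 + (δ k).im ≠ 0 := fun k =>
    (show 0 < h / 2 + (δ k).im by linarith [(abs_lt.1 (hδ k)).1]).ne'
  choose c hc0 hc using fun k => exists_mul_one_add_sq_le (δ k).re (hb k)
  refine ⟨∏ k, c k, Finset.prod_pos fun k _ => hc0 k, fun μ => ?_⟩
  have hfactor : ∀ k, (μ - (δ k).re) ^ 2 + (h / 2 + (δ k).im) ^ 2 =
      ‖(μ : ℂ) - Complex.I * h / 2 - δ k‖ ^ 2 := fun k => by
    rw [Complex.sq_norm, Complex.normSq_apply, Complex.sub_im, im_sub_I_mul_half, Complex.sub_re,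
      re_sub_I_mul_half, Complex.ofReal_re, Complex.ofReal_im]
    ring
  calc (∏ k, c k) * (1 + μ ^ 2) ≤ (∏ k, c k) * (1 + μ ^ 2) ^ N := by
        gcongr
        · exact Finset.prod_nonneg fun k _ => (hc0 k).le
        · exact le_self_pow₀ (le_add_of_nonneg_right (sq_nonneg μ)) (by omega)
    _ = ∏ k, c k * (1 + μ ^ 2) := by simp [Finset.prod_mul_distrib]
    _ ≤ ∏ k, ‖(μ : ℂ) - Complex.I * h / 2 - δ k‖ ^ 2 :=
        Finset.prod_le_prod (fun k _ => mul_nonneg (hc0 k).le (by positivity)) fun k _ =>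
          (hc k μ).trans_eq (hfactor k)
    _ = ‖vartheta δ (μ - Complex.I * h / 2)‖ ^ 2 := by
        rw [vartheta, norm_prod, Finset.prod_pow]

theorem differentiable_gammaProd (h : ℝ) (δ : Fin N → ℂ) : Differentiable ℂ (gammaProd h δ) := by
  intro z
  refine DifferentiableAt.fun_finsetProd fun k _ => ?_
  exact (Complex.differentiable_one_div_Gamma _).comp z
    (f := fun z => 1 - Complex.I * (z - δ k) / h) (by fun_prop)

theorem gammaProd_eq_mul_vartheta (hh : h ≠ 0) (δ : Fin N → ℂ) (z : ℂ) :
    gammaProd h δ z = (-Complex.I / h) ^ N * vartheta δ (z + h * Complex.I) *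
      gammaProd h δ (z + h * Complex.I) := by
  have hc : (h : ℂ) ≠ 0 := Complex.ofReal_ne_zero.2 hh
  have hconst : (-Complex.I / h) ^ N = ∏ _k : Fin N, (-Complex.I / (h : ℂ)) := by
    rw [Finset.prod_const, Finset.card_univ, Fintype.card_fin]
  simp only [gammaProd, vartheta, hconst, ← Finset.prod_mul_distrib]
  refine Finset.prod_congr rfl fun k _ => ?_
  have harg : 1 - Complex.I * (z - δ k) / h = -Complex.I / h * (z + h * Complex.I - δ k) := by
    field_simp
    linear_combination (h : ℂ) * Complex.I_sq
  have hshift : 1 - Complex.I * (z + h * Complex.I - δ k) / h =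
      1 - Complex.I * (z - δ k) / h + 1 := by
    field_simp
    linear_combination (-(h : ℂ)) * Complex.I_sq
  rw [hshift, ← harg]
  exact Complex.one_div_Gamma_eq_self_mul_one_div_Gamma_add_one _

theorem SelfConjugate.conj_gammaProd (hδ : SelfConjugate δ) (h : ℝ) (z : ℂ) :
    starRingEnd ℂ (gammaProd h δ (starRingEnd ℂ z)) =
      ∏ k, (Complex.Gamma (1 + Complex.I * (z - δ k) / h))⁻¹ := by
  obtain ⟨σ, hσ⟩ := hδ
  rw [gammaProd, map_prod, ← Equiv.prod_comp σ]
  refine Finset.prod_congr rfl fun k _ => ?_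
  rw [map_inv₀, ← Complex.Gamma_conj, ← hσ k]
  simp only [map_sub, map_one, map_div₀, map_mul, Complex.conj_I, Complex.conj_ofReal,
    Complex.conj_conj]
  ring_nf

end Vartheta

section EntireExtension

variable {N : ℕ} {L : ℝ → ℝ} {h c : ℝ} {δ : Fin N → ℂ}

/-- The factor by which `cauchyExp L` jumps across the real line when `exp L` is the function
`1 + c Y / (ϑ(· - ih/2) ϑ(· + ih/2))` of a solution `Y` of the integral equation. Unlike `Y`, it is
defined in a complex neighbourhood of the real line. -/
noncomputable def jumpFactor (L : ℝ → ℝ) (h c : ℝ) (δ : Fin N → ℂ) (w : ℂ) : ℂ :=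
  1 + c * (cauchyExp L (w + h * Complex.I) / cauchyExp L (w - h * Complex.I)) /
    (vartheta δ (w - Complex.I * h / 2) * vartheta δ (w + Complex.I * h / 2))

theorem eventually_vartheta_mul_ne_zero (hδ : ∀ k, |(δ k).im| < h / 2) (x : ℝ) :
    ∀ᶠ w in 𝓝 (x : ℂ),
      vartheta δ (w - Complex.I * h / 2) * vartheta δ (w + Complex.I * h / 2) ≠ 0 := by
  have hcont : Continuous fun w : ℂ =>
      vartheta δ (w - Complex.I * h / 2) * vartheta δ (w + Complex.I * h / 2) := by
    have := (differentiable_vartheta δ).continuous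
    fun_prop
  refine hcont.continuousAt.eventually_ne (mul_ne_zero ?_ ?_) <;>
    refine vartheta_ne_zero hδ ?_
  · rw [im_sub_I_mul_half, Complex.ofReal_im, zero_sub, abs_neg]
    exact le_abs_self _
  · rw [im_add_I_mul_half, Complex.ofReal_im, zero_add]
    exact le_abs_self _

theorem differentiableAt_jumpFactor (hL : Integrable L) (c : ℝ) {w : ℂ} (hw : |w.im| < h)
    (hϑ : vartheta δ (w - Complex.I * h / 2) * vartheta δ (w + Complex.I * h / 2) ≠ 0) :
    DifferentiableAt ℂ (jumpFactor L h c δ) w := by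
  obtain ⟨hlow, hup⟩ := abs_lt.1 hw
  have hplus : DifferentiableAt ℂ (fun w => cauchyExp L (w + h * Complex.I)) w :=
    differentiableAt_comp_add_const.2 <| differentiableAt_cauchyExp hL <| by
      simpa using (show 0 < w.im + h by linarith).ne'
  have hminus : DifferentiableAt ℂ (fun w => cauchyExp L (w - h * Complex.I)) w :=
    differentiableAt_comp_sub_const.2 <| differentiableAt_cauchyExp hL <| by
      simpa using (show w.im - h < 0 by linarith).ne
  have hvartheta := differentiable_vartheta δ
  exact (((hplus.div hminus (cauchyExp_ne_zero _ _)).const_mul _).div (by fun_prop) hϑ).const_add _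

/-- The coefficient `q` of the functional equation `F(w) = f(w) + q(w) F(w + ih)` along which
`f(w) = cauchyExp L w * gammaProd h δ (w - ih/2)` is continued from the upper half-plane. -/
noncomputable def transferFactor (L : ℝ → ℝ) (h c : ℝ) (δ : Fin N → ℂ) (w : ℂ) : ℂ :=
  c * (-Complex.I / h) ^ N * cauchyExp L w /
    (cauchyExp L (w - h * Complex.I) * vartheta δ (w - Complex.I * h / 2))

theorem differentiableAt_transferFactor (hL : Integrable L) (hh : 0 < h)
    (hδ : ∀ k, |(δ k).im| < h / 2) {w : ℂ} (hw : w.im < 0) :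
    DifferentiableAt ℂ (transferFactor L h c δ) w := by
  have hV : DifferentiableAt ℂ (fun w => cauchyExp L (w - h * Complex.I)) w :=
    differentiableAt_comp_sub_const.2 <| differentiableAt_cauchyExp hL <| by
      simpa using (show w.im - h < 0 by linarith).ne
  have hϑ : vartheta δ (w - Complex.I * h / 2) ≠ 0 := vartheta_ne_zero hδ <| by
    rw [im_sub_I_mul_half, abs_of_neg (by linarith)]
    linarith
  have hvartheta := differentiable_vartheta δ
  exact ((differentiableAt_cauchyExp hL hw.ne).const_mul _).div (hV.mul (by fun_prop))
    (mul_ne_zero (cauchyExp_ne_zero _ _) hϑ)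

theorem jumpFactor_mul_cauchyExp_mul_gammaProd (hh : h ≠ 0) {w : ℂ}
    (hϑ : vartheta δ (w - Complex.I * h / 2) * vartheta δ (w + Complex.I * h / 2) ≠ 0) :
    jumpFactor L h c δ w * cauchyExp L w * gammaProd h δ (w - Complex.I * h / 2) =
      cauchyExp L w * gammaProd h δ (w - Complex.I * h / 2) +
        transferFactor L h c δ w * (cauchyExp L (w + h * Complex.I) *
          gammaProd h δ (w + h * Complex.I - Complex.I * h / 2)) := by
  obtain ⟨hminus, hplus⟩ := mul_ne_zero_iff.1 hϑ
  have hV := cauchyExp_ne_zero L (w - h * Complex.I)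
  have hshift : w - Complex.I * h / 2 + h * Complex.I = w + Complex.I * h / 2 := by ring
  have hshift' : w + h * Complex.I - Complex.I * h / 2 = w + Complex.I * h / 2 := by ring
  rw [jumpFactor, transferFactor, gammaProd_eq_mul_vartheta hh δ (w - Complex.I * h / 2), hshift,
    hshift']
  generalize vartheta δ (w - Complex.I * h / 2) = ϑminus at *
  generalize vartheta δ (w + Complex.I * h / 2) = ϑplus at *
  generalize cauchyExp L (w - h * Complex.I) = Vminus at *
  field_simp

theorem exists_continuation_cauchyExp_mul_gammaProd (hL : Integrable L) (hh : 0 < h)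
    (hδ : ∀ k, |(δ k).im| < h / 2) (hjump : ∀ x : ℝ, jumpFactor L h c δ x = Real.exp (L x))
    (x : ℝ) : ∃ g : ℂ → ℂ, ∀ᶠ w in 𝓝 (x : ℂ), DifferentiableAt ℂ g w ∧
      (0 < w.im → g w = cauchyExp L w * gammaProd h δ (w - Complex.I * h / 2)) ∧
      (w.im < 0 → g w = cauchyExp L w * gammaProd h δ (w - Complex.I * h / 2) +
        transferFactor L h c δ w * (cauchyExp L (w + h * Complex.I) *
          gammaProd h δ (w + h * Complex.I - Complex.I * h / 2))) := by
  have hG := differentiable_gammaProd h δ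
  have hnear : ∀ᶠ w in 𝓝 (x : ℂ), |w.im| < h :=
    Complex.continuous_im.abs.continuousAt.eventually_lt_const (by simpa using hh)
  have hϑ := eventually_vartheta_mul_ne_zero hδ x
  obtain ⟨g, hg⟩ := exists_continuation_cauchyExp hL
    (hnear.and hϑ |>.mono fun w hw => differentiableAt_jumpFactor hL c hw.1 hw.2)
    (Eventually.of_forall hjump)
  refine ⟨fun w => g w * gammaProd h δ (w - Complex.I * h / 2), ?_⟩
  filter_upwards [hg, hϑ] with w hgw hϑw
  refine ⟨hgw.1.mul (by fun_prop), fun hw => by rw [hgw.2.1 hw], fun hw => ?_⟩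
  rw [hgw.2.2 hw, jumpFactor_mul_cauchyExp_mul_gammaProd hh.ne' hϑw]

theorem exists_entire_cauchyExp_mul_gammaProd (hL : Integrable L) (hh : 0 < h)
    (hδ : ∀ k, |(δ k).im| < h / 2) (hjump : ∀ x : ℝ, jumpFactor L h c δ x = Real.exp (L x)) :
    ∃ E : ℂ → ℂ, Differentiable ℂ E ∧ ∀ z : ℂ, -(h / 2) < z.im →
      E z = cauchyExp L (z + Complex.I * h / 2) * gammaProd h δ z := by
  have hG := differentiable_gammaProd h δ
  obtain ⟨F, hF, hFeq⟩ := exists_entire_of_continuation_across_real hh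
    (f := fun w => cauchyExp L w * gammaProd h δ (w - Complex.I * h / 2))
    (fun w hw => (differentiableAt_cauchyExp hL hw).mul (by fun_prop))
    (fun w hw => differentiableAt_transferFactor hL hh hδ hw)
    (exists_continuation_cauchyExp_mul_gammaProd hL hh hδ hjump)
  refine ⟨fun z => F (z + Complex.I * h / 2), by fun_prop, fun z hz => ?_⟩
  simp only [hFeq (z + Complex.I * h / 2) (by rw [im_add_I_mul_half]; linarith),
    add_sub_cancel_right]

theorem norm_le_of_forall_lt_im {E G : ℂ → ℂ} (hE : Continuous E) (hG : Continuous G)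
    {a K : ℝ} (hle : ∀ z : ℂ, a < z.im → ‖E z‖ ≤ K * ‖G z‖) {z : ℂ} (hz : a ≤ z.im) :
    ‖E z‖ ≤ K * ‖G z‖ := by
  have hclosure : closure {z : ℂ | a < z.im} ⊆ {z : ℂ | ‖E z‖ ≤ K * ‖G z‖} :=
    closure_minimal hle (isClosed_le hE.norm (continuous_const.mul hG.norm))
  rw [Complex.closure_setOfPred_lt_im] at hclosure
  exact hclosure hz

theorem isBigO_gammaProd_of_eq_cauchyExp_mul {E : ℂ → ℂ} (hL : Integrable L) {M : ℝ}
    (hM : ∀ μ, L μ ≤ M) (hEc : Continuous E) (hE : ∀ z : ℂ, -(h / 2) < z.im →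
      E z = cauchyExp L (z + Complex.I * h / 2) * gammaProd h δ z) :
    E =O[stripEnds h] gammaProd h δ := by
  refine Asymptotics.IsBigO.of_bound (Real.exp (M / 2)) ?_
  filter_upwards [eventually_abs_im_le_stripEnds h] with z hz
  refine norm_le_of_forall_lt_im hEc (differentiable_gammaProd h δ).continuous (fun w hw => ?_)
    (abs_le.1 hz).1
  rw [hE w hw, norm_mul]
  gcongr
  exact norm_cauchyExp_le hL hM (by rw [im_add_I_mul_half]; linarith)

end EntireExtension

section RealLogV

variable {N : ℕ} {h c : ℝ} {δ : Fin N → ℂ} {Y : ℝ → ℝ}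

/-- The real form `ln (1 + c Y(μ) / |ϑ(μ - ih/2)|²)` of `logV`, with `c` in place of `ρ^h`. -/
noncomputable def realLogV (h c : ℝ) (δ : Fin N → ℂ) (Y : ℝ → ℝ) (μ : ℝ) : ℝ :=
  Real.log (1 + c * Y μ / ‖vartheta δ ((μ : ℂ) - Complex.I * h / 2)‖ ^ 2)

theorem realLogV_nonneg (hc : 0 ≤ c) (hY : ∀ μ, 0 ≤ Y μ) (μ : ℝ) : 0 ≤ realLogV h c δ Y μ :=
  Real.log_nonneg (le_add_of_nonneg_right (div_nonneg (mul_nonneg hc (hY μ)) (sq_nonneg _)))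

theorem exists_realLogV_le (hN : 1 ≤ N) (hδ : ∀ k, |(δ k).im| < h / 2) (hc : 0 ≤ c)
    (hY : ∀ μ, 0 ≤ Y μ) {B : ℝ} (hYB : ∀ μ, Y μ ≤ B) :
    ∃ D, 0 ≤ D ∧ ∀ μ, realLogV h c δ Y μ ≤ D * (1 + μ ^ 2)⁻¹ := by
  obtain ⟨b, hb, hϑ⟩ := exists_mul_one_add_sq_le_norm_vartheta hN hδ
  have hB : 0 ≤ B := (hY 0).trans (hYB 0)
  refine ⟨c * B / b, by positivity, fun μ => ?_⟩
  have hYμ := hY μ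
  calc realLogV h c δ Y μ ≤ c * Y μ / ‖vartheta δ ((μ : ℂ) - Complex.I * h / 2)‖ ^ 2 :=
        (Real.log_le_sub_one_of_pos (by positivity)).trans_eq (add_sub_cancel_left _ _)
    _ ≤ c * B / (b * (1 + μ ^ 2)) := by
        gcongr
        · exact hYB μ
        · exact hϑ μ
    _ = c * B / b * (1 + μ ^ 2)⁻¹ := by rw [div_mul_eq_div_div, div_eq_mul_inv _ (1 + μ ^ 2)]

theorem integrable_realLogV (hN : 1 ≤ N) (hδ : ∀ k, |(δ k).im| < h / 2) (hc : 0 ≤ c)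
    (hYm : Measurable Y) (hY : ∀ μ, 0 ≤ Y μ) {B : ℝ} (hYB : ∀ μ, Y μ ≤ B) :
    Integrable (realLogV h c δ Y) := by
  obtain ⟨D, -, hD⟩ := exists_realLogV_le hN hδ hc hY hYB
  have hmeas : Measurable (realLogV h c δ Y) := by
    have hϑ := (differentiable_vartheta δ).continuous.measurable
    unfold realLogV
    fun_prop
  refine (integrable_inv_one_add_sq.const_mul D).mono' hmeas.aestronglyMeasurable
    (Eventually.of_forall fun μ => ?_)
  rw [Real.norm_of_nonneg (realLogV_nonneg hc hY μ)]
  exact hD μ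

theorem exists_forall_realLogV_le (hN : 1 ≤ N) (hδ : ∀ k, |(δ k).im| < h / 2) (hc : 0 ≤ c)
    (hY : ∀ μ, 0 ≤ Y μ) {B : ℝ} (hYB : ∀ μ, Y μ ≤ B) : ∃ M, ∀ μ, realLogV h c δ Y μ ≤ M := by
  obtain ⟨D, hD0, hD⟩ := exists_realLogV_le hN hδ hc hY hYB
  exact ⟨D, fun μ => (hD μ).trans <| mul_le_of_le_one_right hD0 <|
    inv_le_one_of_one_le₀ (le_add_of_nonneg_right (sq_nonneg μ))⟩

theorem jumpFactor_realLogV (hL : Integrable (realLogV h c δ Y)) (hh : h ≠ 0) (hc : 0 ≤ c)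
    (hδ : SelfConjugate δ) {x : ℝ} (hY : 0 < Y x)
    (hnlie : Real.log (Y x) = ∫ μ, kernelK h (x - μ) * realLogV h c δ Y μ) :
    jumpFactor (realLogV h c δ Y) h c δ x = Real.exp (realLogV h c δ Y x) := by
  rw [jumpFactor, cauchyExp_add_div_cauchyExp_sub hL hh, ← hnlie, Real.exp_log hY,
    hδ.vartheta_mul_vartheta, realLogV, Real.exp_log (by positivity)]
  push_cast
  rfl

end RealLogV

section BaxterFunctions

variable {N : ℕ} {h g κ : ℝ} {δ : Fin N → ℂ} {Y : ℝ → ℝ}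

theorem rho_rpow_nonneg (N : ℕ) (hκ : 0 ≤ κ) (g h : ℝ) : 0 ≤ rho N g κ ^ h :=
  Real.rpow_nonneg (mul_nonneg hκ (by rw [pow_mul]; positivity)) _

theorem IsNLIESolution.measurable (hY : IsNLIESolution h g κ δ Y) : Measurable Y := by
  have hexp : Y = fun x => Real.exp (Real.log (Y x)) :=
    funext fun x => (Real.exp_log (hY.pos x)).symm
  rw [hexp]
  exact (Real.continuous_exp.comp hY.continuous_log).measurable

theorem IsNLIESolution.bounded (hY : IsNLIESolution h g κ δ Y) : ∃ B, ∀ x, Y x ≤ B := by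
  obtain ⟨C, hC⟩ := hY.log_bounded
  exact ⟨Real.exp C, fun x => (Real.log_le_iff_le_exp (hY.pos x)).1 (hC x)⟩

theorem logV_eq_realLogV (hδ : SelfConjugate δ) (hκ : 0 ≤ κ) (hY : ∀ μ, 0 ≤ Y μ) (μ : ℝ) :
    logV h g κ δ Y μ = realLogV h (rho N g κ ^ h) δ Y μ := by
  have hρ := rho_rpow_nonneg N hκ g h
  have hYμ := hY μ
  rw [logV, realLogV, hδ.vartheta_mul_vartheta, Complex.ofReal_log (by positivity)]
  push_cast
  rfl

theorem upIntegrand_eq (hδ : SelfConjugate δ) (hκ : 0 ≤ κ) (hY : ∀ μ, 0 ≤ Y μ) (z : ℂ) :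
    upIntegrand h g κ δ Y z = fun μ : ℝ => 1 / (2 * Complex.I * Real.pi) *
      ((realLogV h (rho N g κ ^ h) δ Y μ : ℂ) / (z + Complex.I * h / 2 - μ)) := by
  funext μ
  rw [upIntegrand, logV_eq_realLogV hδ hκ hY, sub_add_eq_add_sub]
  ring

theorem downIntegrand_eq (hδ : SelfConjugate δ) (hκ : 0 ≤ κ) (hY : ∀ μ, 0 ≤ Y μ) (z : ℂ) :
    downIntegrand h g κ δ Y z = fun μ : ℝ => 1 / (2 * Complex.I * Real.pi) *
      ((realLogV h (rho N g κ ^ h) δ Y μ : ℂ) / (z - Complex.I * h / 2 - μ)) := by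
  funext μ
  rw [downIntegrand, logV_eq_realLogV hδ hκ hY, sub_right_comm]
  ring

theorem vUp_eq_cauchyExp (hδ : SelfConjugate δ) (hκ : 0 ≤ κ) (hY : ∀ μ, 0 ≤ Y μ) (z : ℂ) :
    vUp h g κ δ Y z = cauchyExp (realLogV h (rho N g κ ^ h) δ Y) (z + Complex.I * h / 2) := by
  rw [vUp, cauchyExp, upIntegrand_eq hδ hκ hY, integral_const_mul, cauchyTransform]

theorem vDownShift_eq_inv_cauchyExp (hδ : SelfConjugate δ) (hκ : 0 ≤ κ) (hY : ∀ μ, 0 ≤ Y μ)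
    (z : ℂ) : vDownShift h g κ δ Y z =
      (cauchyExp (realLogV h (rho N g κ ^ h) δ Y) (z - Complex.I * h / 2))⁻¹ := by
  rw [vDownShift, cauchyExp, ← Complex.exp_neg, neg_neg, downIntegrand_eq hδ hκ hY,
    integral_const_mul, cauchyTransform]

theorem conj_vUp_conj (hδ : SelfConjugate δ) (hκ : 0 ≤ κ) (hY : ∀ μ, 0 ≤ Y μ) (z : ℂ) :
    starRingEnd ℂ (vUp h g κ δ Y (starRingEnd ℂ z)) = vDownShift h g κ δ Y z := by
  rw [vUp_eq_cauchyExp hδ hκ hY, vDownShift_eq_inv_cauchyExp hδ hκ hY, conj_cauchyExp,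
    conj_add_I_mul_half, Complex.conj_conj]

theorem IsNLIESolution.integrable_realLogV (hY : IsNLIESolution h g κ δ Y) (hN : 1 ≤ N)
    (hκ : 0 ≤ κ) (hδ : ∀ k, |(δ k).im| < h / 2) : Integrable (realLogV h (rho N g κ ^ h) δ Y) := by
  obtain ⟨B, hB⟩ := hY.bounded
  exact TodaTBA.integrable_realLogV hN hδ (rho_rpow_nonneg N hκ g h) hY.measurable
    (fun x => (hY.pos x).le) hB

theorem IsNLIESolution.integrable_upIntegrand (hY : IsNLIESolution h g κ δ Y) (hN : 1 ≤ N)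
    (hκ : 0 ≤ κ) (hδ : SelfConjugate δ) (hδs : ∀ k, |(δ k).im| < h / 2) {z : ℂ}
    (hz : -(h / 2) < z.im) : Integrable (upIntegrand h g κ δ Y z) := by
  rw [upIntegrand_eq hδ hκ fun x => (hY.pos x).le]
  refine (integrable_div_sub (hY.integrable_realLogV hN hκ hδs).ofReal ?_).const_mul _
  rw [im_add_I_mul_half]
  linarith

theorem IsNLIESolution.integrable_downIntegrand (hY : IsNLIESolution h g κ δ Y) (hN : 1 ≤ N)
    (hκ : 0 ≤ κ) (hδ : SelfConjugate δ) (hδs : ∀ k, |(δ k).im| < h / 2) {z : ℂ}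
    (hz : z.im < h / 2) : Integrable (downIntegrand h g κ δ Y z) := by
  rw [downIntegrand_eq hδ hκ fun x => (hY.pos x).le]
  refine (integrable_div_sub (hY.integrable_realLogV hN hκ hδs).ofReal ?_).const_mul _
  rw [im_sub_I_mul_half]
  linarith

theorem IsNLIESolution.exists_entire_vUp_mul_gammaProd (hY : IsNLIESolution h g κ δ Y)
    (hN : 1 ≤ N) (hh : 0 < h) (hκ : 0 ≤ κ) (hδ : SelfConjugate δ)
    (hδs : ∀ k, |(δ k).im| < h / 2) :
    ∃ E : ℂ → ℂ, Differentiable ℂ E ∧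
      (∀ z : ℂ, -(h / 2) < z.im → E z = vUp h g κ δ Y z * gammaProd h δ z) ∧
      E =O[stripEnds h] fun z => Real.exp (N * Real.pi / (2 * h) * |z.re|) *
        ‖z‖ ^ ((N : ℝ) / (2 * h) * (-2 * z.im - h)) := by
  have hL := hY.integrable_realLogV hN hκ hδs
  have hρ := rho_rpow_nonneg N hκ g h
  have hY0 : ∀ x, 0 ≤ Y x := fun x => (hY.pos x).le
  obtain ⟨B, hB⟩ := hY.bounded
  obtain ⟨M, hM⟩ := exists_forall_realLogV_le hN hδs hρ hY0 hB
  obtain ⟨E, hEd, hE⟩ := exists_entire_cauchyExp_mul_gammaProd hL hh hδs fun x =>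
    jumpFactor_realLogV hL hh.ne' hρ hδ (hY.pos x) (hY.nlie x)
  refine ⟨E, hEd, fun z hz => by rw [hE z hz, vUp_eq_cauchyExp hδ hκ hY0], ?_⟩
  exact (isBigO_gammaProd_of_eq_cauchyExp_mul hL hM hEd.continuous hE).trans
    (isBigO_gammaProd_stripEnds hh hδ)

theorem ofReal_cpow_eq_exp {b : ℝ} (hb : 0 < b) (w : ℂ) :
    (b : ℂ) ^ w = Complex.exp (Real.log b * w) := by
  rw [Complex.cpow_def_of_ne_zero (Complex.ofReal_ne_zero.2 hb.ne'), Complex.ofReal_log hb.le]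

theorem QplusExpr_eq_exp_mul (hg : 0 < g) (hκ : 0 < κ) (hh : 0 < h) (z : ℂ) :
    QplusExpr h g κ δ Y z =
      Complex.exp (Complex.I * (N / h * Real.log h - Real.log (κ * g ^ N) : ℝ) * z) *
        Complex.exp (-(N * Real.pi / h) * z) * (vUp h g κ δ Y z * gammaProd h δ z) := by
  rw [QplusExpr, gammaProd, Finset.prod_inv_distrib, ofReal_cpow_eq_exp (by positivity),
    ofReal_cpow_eq_exp hh, ← Complex.exp_add, div_eq_mul_inv, mul_assoc (_ * _)]
  congr 3
  push_cast
  ring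

theorem QminusExpr_eq_exp_mul (hg : 0 < g) (hh : 0 < h) (z : ℂ) :
    QminusExpr h g κ δ Y z =
      Complex.exp (Complex.I * (N * Real.log g - N / h * Real.log h : ℝ) * z) *
        Complex.exp (-(N * Real.pi / h) * z) * (vDownShift h g κ δ Y z *
          ∏ k, (Complex.Gamma (1 + Complex.I * (z - δ k) / h))⁻¹) := by
  rw [QminusExpr, Finset.prod_inv_distrib, ofReal_cpow_eq_exp hg, ofReal_cpow_eq_exp hh,
    ← Complex.exp_add, div_eq_mul_inv, mul_assoc (_ * _)]
  congr 3
  push_cast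
  ring

theorem isBigO_exp_I_mul_mul_mul (t : ℝ) (X : ℂ → ℂ) {E : ℂ → ℂ} {F : ℂ → ℝ}
    (hE : E =O[stripEnds h] F) :
    (fun z => Complex.exp (Complex.I * t * z) * X z * E z) =O[stripEnds h]
      fun z => ‖X z‖ * F z := by
  simpa using ((isBigO_exp_I_mul_stripEnds t h).mul
    (Asymptotics.isBigO_refl X _).norm_right).mul hE

theorem isBigO_conj_comp_conj_stripEnds {E : ℂ → ℂ} {F : ℂ → ℝ} (hE : E =O[stripEnds h] F) :
    (fun z => starRingEnd ℂ (E (starRingEnd ℂ z))) =O[stripEnds h]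
      fun z => F (starRingEnd ℂ z) :=
  .of_norm_left (by
    simpa only [Function.comp_def, Complex.norm_conj] using
      (hE.comp_tendsto (tendsto_conj_stripEnds h)).norm_left)

end BaxterFunctions

end TodaTBA

theorem mainTheorem5 (N : ℕ) (hN : 1 ≤ N) (hbar g κ : ℝ) (hhbar : 0 < hbar) (hg : 0 < g)
    (hκ : 0 < κ) (δ : Fin N → ℂ) (hδconj : TodaTBA.SelfConjugate δ)
    (hδstrip : ∀ k, |(δ k).im| < hbar / 2)
    (Y : ℝ → ℝ) (hY : TodaTBA.IsNLIESolution hbar g κ δ Y) :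
    (∀ z : ℂ, -(hbar / 2) < z.im →
      MeasureTheory.Integrable (TodaTBA.upIntegrand hbar g κ δ Y z) MeasureTheory.volume) ∧
    (∀ z : ℂ, z.im < hbar / 2 →
      MeasureTheory.Integrable (TodaTBA.downIntegrand hbar g κ δ Y z) MeasureTheory.volume) ∧
    (∃ Qplus : ℂ → ℂ, Differentiable ℂ Qplus ∧
      (∀ z : ℂ, -(hbar / 2) < z.im → Qplus z = TodaTBA.QplusExpr hbar g κ δ Y z) ∧
      Asymptotics.IsBigO (TodaTBA.stripEnds hbar) Qplus (fun z : ℂ =>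
        ‖Complex.exp (-(N * Real.pi / hbar) * z)‖ *
          (Real.exp (N * Real.pi / (2 * hbar) * |z.re|) *
            ‖z‖ ^ ((N : ℝ) / (2 * hbar) * (-2 * z.im - hbar))))) ∧
    (∃ Qminus : ℂ → ℂ, Differentiable ℂ Qminus ∧
      (∀ z : ℂ, z.im < hbar / 2 → Qminus z = TodaTBA.QminusExpr hbar g κ δ Y z) ∧
      Asymptotics.IsBigO (TodaTBA.stripEnds hbar) Qminus (fun z : ℂ =>
        ‖Complex.exp (-(N * Real.pi / hbar) * z)‖ *
          (Real.exp (N * Real.pi / (2 * hbar) * |z.re|) *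
            ‖z‖ ^ ((N : ℝ) / (2 * hbar) * (2 * z.im - hbar))))) := by
  obtain ⟨E, hEd, hE, hEO⟩ :=
    hY.exists_entire_vUp_mul_gammaProd hN hhbar hκ.le hδconj hδstrip
  have hEd' : Differentiable ℂ fun z => starRingEnd ℂ (E (starRingEnd ℂ z)) := fun z =>
    differentiableAt_conj_conj_iff.2 (hEd _)
  have hY0 : ∀ x, 0 ≤ Y x := fun x => (hY.pos x).le
  refine ⟨fun z => hY.integrable_upIntegrand hN hκ.le hδconj hδstrip,
    fun z => hY.integrable_downIntegrand hN hκ.le hδconj hδstrip,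
    ⟨fun z => Complex.exp (Complex.I * (N / hbar * Real.log hbar - Real.log (κ * g ^ N) : ℝ) * z) *
        Complex.exp (-(N * Real.pi / hbar) * z) * E z,
      by fun_prop, fun z hz => ?_, TodaTBA.isBigO_exp_I_mul_mul_mul _ _ hEO⟩,
    ⟨fun z => Complex.exp (Complex.I * (N * Real.log g - N / hbar * Real.log hbar : ℝ) * z) *
        Complex.exp (-(N * Real.pi / hbar) * z) * starRingEnd ℂ (E (starRingEnd ℂ z)),
      by fun_prop, fun z hz => ?_, (TodaTBA.isBigO_exp_I_mul_mul_mul _ _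
        (TodaTBA.isBigO_conj_comp_conj_stripEnds hEO)).congr_right fun z => by simp⟩⟩
  · simp only [TodaTBA.QplusExpr_eq_exp_mul hg hκ hhbar, hE z hz]
  · have hzconj : -(hbar / 2) < (starRingEnd ℂ z).im := by simpa using neg_lt_neg hz
    simp only [TodaTBA.QminusExpr_eq_exp_mul hg hhbar, hE _ hzconj, map_mul,
      TodaTBA.conj_vUp_conj hδconj hκ.le hY0, hδconj.conj_gammaProd]
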